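/- For a set $\mathcal{C}$ of cycles let $\mathrm{ex}(n,\mathcal{C})$ be the maximum number of edges of an $n$-vertex simple graph containing none of the cycles in $\mathcal{C}$ as a subgraph. A generalized $m$-gon is a point-line geometry whose (bipartite) incidence graph has diameter $m$ and girth $2m$; it has order $q$ if every line is incident with exactly $q+1$ points and every point with exactly $q+1$ lines. A polarity $\pi$ is an incidence-preserving involution that interchanges points and lines, and the polarity graph of $\pi$ has the points as vertices, two distinct points $p,p'$ being adjacent when $p$ is incident with $\pi(p')$. Let $k\ge 2$ be an integer. Then, for all $n \ge 0$, \[ \mathrm{ex}(n,\{C_4,C_6,\dots,C_{2k}\}) \;\le\; \tfrac12 n^{1+1/k} + 2^{k^2} n . \] Furthermore, let $k\in\{2,3,5\}$. Then there is a constant $C$ such that, for every finite generalized $(k+1)$-gon of some order $q$ and every polarity $\pi$ of it, the polarity graph of $\pi$ contains no even cycle of length at most $2k$, and its number of edges differs from $\tfrac12 n^{1+1/k}$ by at most $Cn$, where $n$ is its number of vertices. Moreover, such geometries exist: a finite generalized $(k+1)$-gon of order $q$ with a polarity exists for every prime power $q$ if $k=2$, for every $q=2^{2e+1}$, $e\ge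 0$, if $k=3$, and for every $q=3^{2e+1}$, $e\ge 0$, if $k=5$. -/

import Mathlib

/-- `G` contains no cycle `C_ℓ` (as a not necessarily induced subgraph) with `ℓ ∈ S`. -/
def CycleFree {V : Type*} (S : Set ℕ) (G : SimpleGraph V) : Prop :=
  ∀ ℓ ∈ S, (SimpleGraph.cycleGraph ℓ).Free G

/-- The set of lengths `{4, 6, …, 2k}`. -/
def shortEvenLengths (k : ℕ) : Set ℕ := {ℓ | Even ℓ ∧ 4 ≤ ℓ ∧ ℓ ≤ 2 * k}

open scoped Classical in
/-- `ex(n, 𝒞)` for the set of cycles `𝒞 = {C_ℓ : ℓ ∈ S}`: the maximum number of edges of an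
`n`-vertex graph that contains none of the cycles in `𝒞`. -/
noncomputable def exCycles (n : ℕ) (S : Set ℕ) : ℕ :=
  (Finset.univ.filter fun G : SimpleGraph (Fin n) => CycleFree S G).sup fun G => G.edgeFinset.card

/-- The incidence graph (Levi graph) of a point-line geometry with points `P`, lines `L` and
incidence relation `I`. -/
def incidenceGraph {P L : Type*} (I : P → L → Prop) : SimpleGraph (P ⊕ L) where
  Adj
    | Sum.inl p, Sum.inr l => I p l
    | Sum.inr l, Sum.inl p => I p l
    | _, _ => False
  symm := ⟨by rintro (p | l) (p' | l') h <;> exact h⟩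
  loopless := ⟨by rintro (p | l) h <;> exact h⟩

/-- A generalized `m`-gon: the incidence graph has diameter `m` and girth `2m`. -/
structure IsGeneralizedPolygon {P L : Type*} (I : P → L → Prop) (m : ℕ) : Prop where
  ediam_eq : (incidenceGraph I).ediam = (m : ℕ∞)
  egirth_eq : (incidenceGraph I).egirth = ((2 * m : ℕ) : ℕ∞)

/-- The geometry has order `q` (that is, order `(q, q)`): every line is incident with exactly
`q + 1` points and every point is incident with exactly `q + 1` lines. -/
structure HasOrder {P L : Type*} (I : P → L → Prop) (q : ℕ) : Prop where
  points_on_line : ∀ l : L, {p : P | I p l}.ncard = q + 1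
  lines_through_point : ∀ p : P, {l : L | I p l}.ncard = q + 1

/-- A polarity: an incidence-preserving involution of `P ⊔ L` that interchanges points and lines.
It maps a point `p` to the line `toLine p` and a line `l` to the point `toLine.symm l`. -/
structure Polarity {P L : Type*} (I : P → L → Prop) where
  toLine : P ≃ L
  incident_iff : ∀ (p : P) (l : L), I p l ↔ I (toLine.symm l) (toLine p)

/-- The polarity graph of `π`: its vertices are the points, and two distinct points `p`, `p'` are
adjacent when `p` is incident with the line `π(p')`. -/
def Polarity.graph {P L : Type*} {I : P → L → Prop} (π : Polarity I) : SimpleGraph P where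
  Adj p p' := p ≠ p' ∧ I p (π.toLine p')
  symm := ⟨fun p p' h => ⟨h.1.symm, by
    have := (π.incident_iff p (π.toLine p')).1 h.2
    rwa [Equiv.symm_apply_apply] at this⟩⟩
  loopless := ⟨fun _ h => h.1 rfl⟩

/-- The orders `q` of the classical self-polar generalized `(k + 1)`-gons, `k ∈ {2, 3, 5}`:
prime powers for projective planes, odd powers of `2` for generalized quadrangles and odd powers
of `3` for generalized hexagons. -/
def IsPolarityOrder (k q : ℕ) : Prop :=
  (k = 2 ∧ IsPrimePow q) ∨ (k = 3 ∧ ∃ e : ℕ, q = 2 ^ (2 * e + 1)) ∨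
    (k = 5 ∧ ∃ e : ℕ, q = 3 ^ (2 * e + 1))

/-!
**Upper bound.** Let `G` have no even cycle of length at most `2k`. Call a walk *admissible* if it
never backtracks and never runs along two consecutive edges of an odd cycle of length at most `k`.
An admissible walk of length at most `k` is determined by its length and its ends
(`IsAdmissibleWalk.unique`): two of them that differ at both ends form cycles at either end which
are odd, hence longer than `k`; so these overlap, and the union of the walks, which has at most `2k`
edges, contains an even cycle. Hence there are at most `n²` admissible walks of length `k`.
On the other hand two short odd cycles through an edge would form a theta graph, so a step has at
most one forbidden continuation besides backtracking (`ShortOdd.unique`). The forbidden continuations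
at a vertex thus form a matching of its neighbours, and there is a doubly stochastic matrix with
entries at most `1 / (d - 3)` that avoids it (`exists_admissible_kernel`). It preserves the uniform
distribution on directed edges, so that the entropy of the random walk it defines is at least that
of a regular graph of the same average degree `d`, up to a constant loss in `d`: there are at least
`n (d - 6) ^ k` admissible walks (`average_degree_sub_pow_le`). Comparing, `d ≤ n ^ (1 / k) + 6`.

**Polarity graphs.** Replacing every other vertex of an even cycle of the polarity graph by its
polar line gives a cycle of the same length in the incidence graph, whose girth is `2k + 2`. All
degrees are `q` or `q + 1`, and `q ^ k ≤ n ≤ (q + 1) ^ k`, the first by the girth and the second by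
the diameter, so that `n ^ (1 / k)` lies between `q` and `q + 1` as well.

**Existence.** Coordinates with respect to a flag describe the incidence graph as two trees of depth
`k`, made of the sequences of length at most `k` over the field `F`, joined at their roots and by a
relation `R` between their leaves. If `R` is symmetric then exchanging the trees is a polarity; for
the symplectic quadrangle and the split Cayley hexagon this requires the characteristic to be `2`
or `3` and an endomorphism `θ` whose square is the Frobenius endomorphism, which exists when the
order is an odd power of the characteristic. A path between the roots that avoids the edge between
them has to climb one tree and descend the other, so no cycle through this edge is shorter than
`2 (k + 1)`. With enough automorphisms, a translation and a reflection in each case, every edge is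
equivalent to this one (`TreeGeometry.exists_aut_of_adj`), which settles girth and diameter
(`TreeGeometry.isGeneralizedPolygon`).
-/

/-! ### Paths, short cycles and admissible walks -/

/-- The restriction of `P : ℕ → V` to `{0, …, a}` is a path of length `a` in `G`. -/
structure IsPathOn {V : Type*} (G : SimpleGraph V) (P : ℕ → V) (a : ℕ) : Prop where
  adj : ∀ i < a, G.Adj (P i) (P (i + 1))
  inj : ∀ i ≤ a, ∀ j ≤ a, P i = P j → i = j

lemma cycleGraph_isContained_of_closed {V : Type*} {G : SimpleGraph V} {f : ℕ → V} {n : ℕ}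
    (hn : 3 ≤ n) (hinj : ∀ i < n, ∀ j < n, f i = f j → i = j)
    (hadj : ∀ i, i + 1 < n → G.Adj (f i) (f (i + 1))) (hclose : G.Adj (f (n - 1)) (f 0)) :
    (SimpleGraph.cycleGraph n).IsContained G := by
  refine ⟨⟨⟨fun i => f i, ?_⟩, ?_⟩⟩
  · have key : ∀ u v : Fin n, (u - v).val = 1 → G.Adj (f u) (f v) := by
      intro u v h
      rcases le_or_gt v u with h' | h'
      · rw [Fin.sub_val_of_le h'] at h
        have : (u : ℕ) = v + 1 := by have := Fin.le_def.1 h'; omega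
        have h2 := hadj v (by omega)
        rw [this]; exact h2.symm
      · rw [Fin.coe_sub_iff_lt.mpr h'] at h
        have h0 : (u : ℕ) = 0 := by omega
        have h1 : (v : ℕ) = n - 1 := by omega
        rw [h0, h1]; exact hclose.symm
    intro u v h
    rcases SimpleGraph.cycleGraph_adj'.1 h with h | h
    · exact key u v h
    · exact (key v u h).symm
  · intro u v h
    exact Fin.ext (hinj u u.2 v v.2 h)

namespace IsPathOn

variable {V : Type*} {G : SimpleGraph V} {P Q : ℕ → V} {a b : ℕ}

lemma mono (h : IsPathOn G P a) (hb : b ≤ a) : IsPathOn G P b :=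
  ⟨fun i hi => h.adj i (by omega), fun i hi j hj => h.inj i (by omega) j (by omega)⟩

lemma reverse (h : IsPathOn G P a) : IsPathOn G (fun i => P (a - i)) a := by
  refine ⟨fun i hi => ?_, fun i hi j hj e => ?_⟩
  · have := h.adj (a - (i + 1)) (by omega)
    rw [show a - (i + 1) + 1 = a - i by omega] at this
    exact this.symm
  · have := h.inj _ (by omega) _ (by omega) e
    omega

/-- A path up to its vertex `i`, followed by another path from that vertex, its vertex `m`, on. -/
lemma splice (hP : IsPathOn G P a) (hQ : IsPathOn G Q b) {i m : ℕ} (hi : i ≤ a) (hm : m ≤ b)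
    (him : P i = Q m) (hdisj : ∀ s < i, ∀ t ≤ b, m < t → P s ≠ Q t) :
    IsPathOn G (fun t => if t ≤ i then P t else Q (t - i + m)) (i + (b - m)) := by
  refine ⟨fun t ht => ?_, fun s hs t ht e => ?_⟩
  · rcases lt_trichotomy t i with h | h | h
    · simp only [if_pos h.le, if_pos (show t + 1 ≤ i from h)]
      exact hP.adj t (by omega)
    · subst h
      simp only [le_refl, if_true, if_neg (show ¬ t + 1 ≤ t by omega)]
      rw [him, show t + 1 - t + m = m + 1 by omega]
      exact hQ.adj m (by omega)
    · simp only [if_neg (show ¬ t ≤ i by omega), if_neg (show ¬ t + 1 ≤ i by omega)]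
      rw [show t + 1 - i + m = t - i + m + 1 by omega]
      exact hQ.adj _ (by omega)
  · have key : ∀ s ≤ i, ∀ t, i < t → t ≤ i + (b - m) → P s ≠ Q (t - i + m) := by
      intro s hs t ht ht' e
      rcases hs.lt_or_eq with h | h
      · exact hdisj s h _ (by omega) (by omega) e
      · subst h
        rw [him] at e
        have := hQ.inj _ hm _ (by omega) e
        omega
    by_cases h1 : s ≤ i <;> by_cases h2 : t ≤ i
    · simp only [if_pos h1, if_pos h2] at e
      exact hP.inj _ (by omega) _ (by omega) e
    · simp only [if_pos h1, if_neg h2] at e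
      exact absurd e (key s h1 t (by omega) ht)
    · simp only [if_pos h2, if_neg h1] at e
      exact absurd e.symm (key t h2 s (by omega) hs)
    · simp only [if_neg h1, if_neg h2] at e
      have := hQ.inj _ (by omega) _ (by omega) e
      omega

/-- Two internally disjoint paths with the same ends, not both single edges, form a cycle. -/
lemma cycleGraph_isContained (hP : IsPathOn G P a) (hQ : IsPathOn G Q b) (hb : 1 ≤ b)
    (hab : 3 ≤ a + b) (h0 : P 0 = Q 0) (h1 : P a = Q b)
    (hdisj : ∀ i, 1 ≤ i → i < a → ∀ j ≤ b, P i ≠ Q j) :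
    (SimpleGraph.cycleGraph (a + b)).IsContained G := by
  have key := hP.splice (hQ.reverse.mono (Nat.sub_le b 1)) (le_refl a) (Nat.zero_le _)
    (by simpa using h1) (by
      intro s hs t ht hmt e
      rcases Nat.eq_zero_or_pos s with h | h
      · subst h
        rw [h0] at e
        have := hQ.inj 0 (by omega) _ (by omega) e
        omega
      · exact hdisj s h hs _ (by omega) e)
  refine cycleGraph_isContained_of_closed (by omega)
    (fun i hi j hj => key.inj i (by omega) j (by omega)) (fun i hi => key.adj i (by omega)) ?_
  have hlast : (if a + b - 1 ≤ a then P (a + b - 1) else Q (b - (a + b - 1 - a + 0))) = Q 1 := by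
    split_ifs with h
    · obtain rfl : b = 1 := by omega
      simpa using h1
    · congr 1; omega
  simp only [Nat.zero_le, if_true, hlast, h0]
  exact (hQ.adj 0 (by omega)).symm

end IsPathOn

/-- `G` contains no even cycle of length at most `2k`: two internally disjoint paths with the same
ends and lengths of the same parity are too long. -/
lemma CycleFree.false_of_paths {V : Type*} {G : SimpleGraph V} {k : ℕ}
    (hG : CycleFree (shortEvenLengths k) G) {P Q : ℕ → V} {a b : ℕ}
    (hP : IsPathOn G P a) (hQ : IsPathOn G Q b) (hb : 1 ≤ b) (hab : 3 ≤ a + b)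
    (h0 : P 0 = Q 0) (h1 : P a = Q b) (hdisj : ∀ i, 1 ≤ i → i < a → ∀ j ≤ b, P i ≠ Q j)
    (heven : Even (a + b)) (hle : a + b ≤ 2 * k) : False := by
  refine hG (a + b) ⟨heven, ?_, hle⟩ (hP.cycleGraph_isContained hQ hb hab h0 h1 hdisj)
  obtain ⟨r, hr⟩ := heven
  omega

/-- `u`, `v`, `w` are consecutive vertices of an odd cycle of length `a + 1 ≤ k`, encoded by the
path of even length `a` from `v` over `w` to `u`; the edge `uv` is not part of the data. -/
def ShortOdd {V : Type*} (G : SimpleGraph V) (k : ℕ) (u v w : V) : Prop :=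
  ∃ (a : ℕ) (R : ℕ → V), Even a ∧ 2 ≤ a ∧ a + 1 ≤ k ∧ IsPathOn G R a ∧ R 0 = v ∧ R 1 = w ∧ R a = u

/-- The admissible continuations `w` of the step from `u` to `v`: no backtracking, and no two
consecutive edges of an odd cycle of length at most `k`. -/
def Admissible {V : Type*} (G : SimpleGraph V) (k : ℕ) (u v w : V) : Prop :=
  G.Adj v w ∧ w ≠ u ∧ ¬ ShortOdd G k u v w

namespace ShortOdd

variable {V : Type*} {G : SimpleGraph V} {k : ℕ} {u v w w' : V}

lemma adj (h : ShortOdd G k u v w) : G.Adj v w := by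
  obtain ⟨a, R, -, h2, -, hR, rfl, rfl, rfl⟩ := h
  exact hR.adj 0 (by omega)

lemma symm (h : ShortOdd G k u v w) (huv : G.Adj u v) : ShortOdd G k w v u := by
  obtain ⟨a, R, ha, h2, hk, hR, rfl, rfl, rfl⟩ := h
  refine ⟨a, fun i => if i = 0 then R 0 else R (a + 1 - i), ha, h2, hk, ⟨fun i hi => ?_, ?_⟩, ?_, ?_,
    ?_⟩
  · rcases Nat.eq_zero_or_pos i with h | h
    · subst h
      simpa using huv.symm
    · simp only [if_neg (show i ≠ 0 by omega), if_neg (show i + 1 ≠ 0 by omega)]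
      have := hR.adj (a - i) (by omega)
      rw [show a + 1 - i = a - i + 1 by omega, show a + 1 - (i + 1) = a - i by omega]
      exact this.symm
  · intro i hi j hj e
    by_cases h1 : i = 0 <;> by_cases h2 : j = 0 <;> simp only [h1, h2, if_true, if_false] at e ⊢
    · have := hR.inj _ (by omega) _ (by omega) e
      omega
    · have := hR.inj _ (by omega) _ (by omega) e
      omega
    · have := hR.inj _ (by omega) _ (by omega) e
      omega
  · simp
  · simp
  · simp only [if_neg (show a ≠ 0 by omega)]
    congr 1; omega

/-- Two odd cycles of length at most `k` through the edge `uv` would form a theta graph, one of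
whose cycles is even and has length less than `2k`. -/
lemma unique (hG : CycleFree (shortEvenLengths k) G) (huv : G.Adj u v)
    (h : ShortOdd G k u v w) (h' : ShortOdd G k u v w') : w = w' := by
  classical
  obtain ⟨a, R, ha, h2, hk, hR, h0, h1, hu⟩ := h
  obtain ⟨a', R', ha', h2', hk', hR', h0', h1', hu'⟩ := h'
  by_contra hne
  have hex : ∃ i, 1 ≤ i ∧ ∃ m ≤ a', R i = R' m := ⟨a, by omega, a', le_rfl, by rw [hu, hu']⟩
  obtain ⟨hi, m, hm, him⟩ := Nat.find_spec hex
  have hmin : ∀ s, 1 ≤ s → s < Nat.find hex → ∀ t ≤ a', R s ≠ R' t := fun s hs hlt t ht e =>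
    Nat.find_min hex hlt ⟨hs, t, ht, e⟩
  have hia : Nat.find hex ≤ a := Nat.find_min' hex ⟨by omega, a', le_rfl, by rw [hu, hu']⟩
  set i := Nat.find hex
  have hm1 : 1 ≤ m := by
    rcases Nat.eq_zero_or_pos m with h | h
    · subst h
      rw [h0', ← h0] at him
      have := hR.inj _ hia _ (by omega) him
      omega
    · exact h
  have him3 : 3 ≤ i + m := by
    by_contra hlt
    have e1 : i = 1 := by omega
    have e2 : m = 1 := by omega
    rw [e1, e2, h1, h1'] at him
    exact hne him
  have hodd : ¬ Even (i + m) := fun he =>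
    hG.false_of_paths (hR.mono hia) (hR'.mono hm) hm1 him3 (by rw [h0, h0']) him
      (fun s hs hlt t ht => hmin s hs hlt t (by omega)) he (by omega)
  have hia' : i ≠ a := by
    intro e
    rw [e, hu, ← hu'] at him
    have := hR'.inj _ le_rfl _ hm him
    exact hodd (by rw [e, ← this]; exact ha.add ha')
  have hma' : m ≠ a' := by
    intro e
    rw [e, hu', ← hu] at him
    exact hia' (hR.inj _ hia _ le_rfl him)
  have hS := hR.splice hR' hia hm him (by
    intro s hs t ht hmt e
    rcases Nat.eq_zero_or_pos s with h | h
    · subst h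
      rw [h0, ← h0'] at e
      have := hR'.inj _ (by omega) _ ht e
      omega
    · exact hmin s h hs t ht e)
  have hE : IsPathOn G (fun t => if t = 0 then v else u) 1 := by
    refine ⟨fun t ht => ?_, fun s hs t ht e => ?_⟩
    · obtain rfl : t = 0 := by omega
      simpa using huv.symm
    · have := huv.ne
      interval_cases s <;> interval_cases t <;> simp_all
  refine hG.false_of_paths hE hS (by omega) (by omega) (by simp [h0]) ?_
    (fun s hs hlt => by omega) ?_ (by omega)
  · simp only [one_ne_zero, if_false, if_neg (show ¬ i + (a' - m) ≤ i by omega)]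
    rw [← hu']; congr 1; omega
  · rw [Nat.even_iff] at *
    omega

end ShortOdd

/-- `P` restricted to `{0, …, j}` is a walk all of whose steps are admissible continuations. -/
structure IsAdmissibleWalk {V : Type*} (G : SimpleGraph V) (k : ℕ) (P : ℕ → V) (j : ℕ) : Prop where
  adj : ∀ i < j, G.Adj (P i) (P (i + 1))
  admissible : ∀ i, i + 2 ≤ j → Admissible G k (P i) (P (i + 1)) (P (i + 2))

namespace IsAdmissibleWalk

variable {V : Type*} {G : SimpleGraph V} {k : ℕ} {P Q : ℕ → V} {j : ℕ}

lemma mono (h : IsAdmissibleWalk G k P j) {i : ℕ} (hi : i ≤ j) : IsAdmissibleWalk G k P i :=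
  ⟨fun s hs => h.adj s (by omega), fun s hs => h.admissible s (by omega)⟩

lemma shift (h : IsAdmissibleWalk G k P (j + 1)) : IsAdmissibleWalk G k (fun i => P (i + 1)) j :=
  ⟨fun s hs => h.adj (s + 1) (by omega), fun s hs => h.admissible (s + 1) (by omega)⟩

lemma reverse (h : IsAdmissibleWalk G k P j) : IsAdmissibleWalk G k (fun i => P (j - i)) j := by
  refine ⟨fun i hi => ?_, fun i hi => ?_⟩
  · have := h.adj (j - (i + 1)) (by omega)
    rw [show j - (i + 1) + 1 = j - i by omega] at this
    exact this.symm
  · have h1 := h.admissible (j - (i + 2)) (by omega)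
    have h2 := h.adj (j - (i + 2)) (by omega)
    rw [show j - (i + 2) + 1 = j - (i + 1) by omega] at h1 h2
    rw [show j - (i + 2) + 2 = j - i by omega] at h1
    exact ⟨h2.symm, h1.2.1.symm, fun hs => h1.2.2 (hs.symm h1.1.symm)⟩

/-- A first repetition would close a cycle of length at most `k` containing two consecutive edges
of the walk. -/
lemma isPathOn (hG : CycleFree (shortEvenLengths k) G) (h : IsAdmissibleWalk G k P j) (hj : j ≤ k) :
    IsPathOn G P j := by
  have key : ∀ l, 1 ≤ l → ∀ i, i + l ≤ j → P i ≠ P (i + l) := by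
    intro l
    induction l using Nat.strong_induction_on with
    | _ l ih =>
      intro hl i hi e
      have h1 := h.adj i (by omega)
      rcases (by omega : l = 1 ∨ l = 2 ∨ 3 ≤ l) with hl1 | hl2 | hl3
      · subst hl1
        exact h1.ne e
      · subst hl2
        exact (h.admissible i hi).2.1 e.symm
      · have hR : IsPathOn G (fun t => P (i + 1 + t)) (l - 1) := by
          have aux : ∀ s ≤ l - 1, ∀ t ≤ l - 1, s < t → P (i + 1 + s) ≠ P (i + 1 + t) := by
            intro s hs t ht hst
            have := ih (t - s) (by omega) (by omega) (i + 1 + s) (by omega)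
            rwa [show i + 1 + s + (t - s) = i + 1 + t by omega] at this
          refine ⟨fun t ht => h.adj (i + 1 + t) (by omega), fun s hs t ht e => ?_⟩
          rcases lt_trichotomy s t with h | h | h
          · exact absurd e (aux s hs t ht h)
          · exact h
          · exact absurd e.symm (aux t ht s hs h)
        have hend : P (i + 1 + (l - 1)) = P i := by rw [e]; congr 1; omega
        rcases Nat.even_or_odd l with hev | hod
        · refine hG l ⟨hev, ?_, by omega⟩ ?_
          · rw [Nat.even_iff] at hev; omega
          · refine cycleGraph_isContained_of_closed (f := fun t => P (i + 1 + t)) hl3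
              (fun s hs t ht => hR.inj s (by omega) t (by omega))
              (fun t ht => hR.adj t (by omega)) ?_
            simp only [hend]
            exact h1
        · refine (h.admissible i (by omega)).2.2 ⟨l - 1, _, ?_, by omega, by omega, hR, ?_, ?_, hend⟩
          · rw [Nat.odd_iff] at hod; rw [Nat.even_iff]; omega
          · rfl
          · rfl
  refine ⟨h.adj, fun s hs t ht e => ?_⟩
  rcases lt_trichotomy s t with h | h | h
  · have := key (t - s) (by omega) s (by omega)
    rw [show s + (t - s) = t by omega] at this
    exact absurd e this
  · exact h
  · have := key (s - t) (by omega) t (by omega)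
    rw [show t + (s - t) = s by omega] at this
    exact absurd e.symm this

/-- The cycle formed by initial segments of two admissible walks is odd of length more than `k`:
otherwise one of the two segments has two consecutive edges on it. -/
lemma lt_of_first_meeting (hG : CycleFree (shortEvenLengths k) G) (hP : IsAdmissibleWalk G k P j)
    (hQ : IsAdmissibleWalk G k Q j) (hj : j ≤ k) (h0 : P 0 = Q 0) {i m : ℕ} (hi1 : 1 ≤ i)
    (hm1 : 1 ≤ m) (hi : i ≤ j) (hm : m ≤ j) (him3 : 3 ≤ i + m) (him : P i = Q m)
    (hdisj : ∀ s, 1 ≤ s → s < i → ∀ t ≤ m, P s ≠ Q t) : Odd (i + m) ∧ k < i + m := by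
  have hP' := hP.isPathOn hG hj
  have hQ' := hQ.isPathOn hG hj
  have hodd : Odd (i + m) := by
    rw [← Nat.not_even_iff_odd]
    exact fun he => hG.false_of_paths (hP'.mono hi) (hQ'.mono hm) hm1 him3 h0 him hdisj he
      (by omega)
  refine ⟨hodd, ?_⟩
  by_contra hle
  -- A segment with at least two edges has its first two edges on the short odd cycle.
  have aux : ∀ {A B : ℕ → V} {x y : ℕ}, IsAdmissibleWalk G k A j → IsPathOn G A j → IsPathOn G B j →
      A 0 = B 0 → A x = B y → 2 ≤ x → 1 ≤ y → x ≤ j → y ≤ j → Odd (x + y) → x + y ≤ k →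
      (∀ s, 1 ≤ s → s < x → ∀ t ≤ y, A s ≠ B t) → False := by
    intro A B x y hA hA' hB' h0 hxy hx hy hxj hyj hodd hle hd
    have hA1 : IsPathOn G (fun t => A (t + 1)) (x - 1) :=
      ⟨fun t ht => hA'.adj (t + 1) (by omega), fun s hs t ht e => by
        have := hA'.inj _ (by omega) _ (by omega) e
        omega⟩
    have hS := hA1.splice (hB'.mono hyj).reverse (le_refl (x - 1)) (Nat.zero_le _)
      (by simp only [Nat.sub_zero, ← hxy]; congr 1; omega) (by
        intro s hs t ht _ e
        exact hd (s + 1) (by omega) (by omega) _ (by omega) e)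
    refine (hA.admissible 0 (by omega)).2.2 ⟨_, _, ?_, ?_, ?_, hS, ?_, ?_, ?_⟩
    · rw [Nat.odd_iff] at hodd
      rw [Nat.even_iff]
      omega
    · omega
    · omega
    · simp
    · simp [show 1 ≤ x - 1 by omega]
    · simp only [if_neg (show ¬ x - 1 + (y - 0) ≤ x - 1 by omega), h0]
      congr 1
      omega
  rcases (by omega : 2 ≤ i ∨ 2 ≤ m) with h | h
  · exact aux hP hP' hQ' h0 him h hm1 hi hm hodd (by omega) hdisj
  · refine aux hQ hQ' hP' h0.symm him.symm h hi1 hm hi (by rwa [add_comm]) (by omega) ?_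
    intro s hs hlt t ht e
    rcases Nat.eq_zero_or_pos t with h | h
    · subst h
      rw [h0] at e
      have := hQ'.inj _ (by omega) _ (by omega) e
      omega
    · rcases ht.lt_or_eq with h' | h'
      · exact hdisj t h h' s hlt.le e.symm
      · rw [h', him] at e
        have := hQ'.inj _ (by omega) _ (by omega) e
        omega

/-- Two admissible walks of the same length at most `k` and with the same ends cannot differ both
in their first and in their last steps: the cycles at their two ends are odd and longer than `k`,
so they overlap, and then there is an even cycle in the union of the walks. -/
lemma false_of_ne_ends (hG : CycleFree (shortEvenLengths k) G) (hP : IsAdmissibleWalk G k P j)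
    (hQ : IsAdmissibleWalk G k Q j) (hj : j ≤ k) (hj2 : 2 ≤ j) (h0 : P 0 = Q 0) (h1 : P j = Q j)
    (hfirst : P 1 ≠ Q 1) (hlast : P (j - 1) ≠ Q (j - 1)) : False := by
  classical
  have hP' := hP.isPathOn hG hj
  have hQ' := hQ.isPathOn hG hj
  have hex : ∃ i, 1 ≤ i ∧ ∃ m ≤ j, P i = Q m := ⟨j, by omega, j, le_rfl, h1⟩
  have hex' : ∃ i, 1 ≤ i ∧ ∃ m ≤ j, P (j - i) = Q (j - m) :=
    ⟨j, by omega, j, le_rfl, by simpa using h0⟩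
  obtain ⟨hi, m, hm, him⟩ := Nat.find_spec hex
  obtain ⟨hi', m', hm', him'⟩ := Nat.find_spec hex'
  have hmin : ∀ s, 1 ≤ s → s < Nat.find hex → ∀ t ≤ j, P s ≠ Q t := fun s hs hlt t ht e =>
    Nat.find_min hex hlt ⟨hs, t, ht, e⟩
  have hmin' : ∀ s, 1 ≤ s → s < Nat.find hex' → ∀ t ≤ j, P (j - s) ≠ Q (j - t) :=
    fun s hs hlt t ht e => Nat.find_min hex' hlt ⟨hs, t, ht, e⟩
  have hia : Nat.find hex ≤ j := Nat.find_min' hex ⟨by omega, j, le_rfl, h1⟩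
  have hia' : Nat.find hex' ≤ j := Nat.find_min' hex' ⟨by omega, j, le_rfl, by simpa using h0⟩
  set i := Nat.find hex
  set i' := Nat.find hex'
  have hm1 : 1 ≤ m := by
    rcases Nat.eq_zero_or_pos m with h | h
    · subst h
      rw [← h0] at him
      have := hP'.inj _ hia _ (by omega) him
      omega
    · exact h
  have hm1' : 1 ≤ m' := by
    rcases Nat.eq_zero_or_pos m' with h | h
    · subst h
      rw [Nat.sub_zero, ← h1] at him'
      have := hP'.inj _ (by omega) _ (by omega) him'
      omega
    · exact h
  have him3 : 3 ≤ i + m := by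
    by_contra hlt
    have e1 : i = 1 := by omega
    have e2 : m = 1 := by omega
    rw [e1, e2] at him
    exact hfirst him
  have him3' : 3 ≤ i' + m' := by
    by_contra hlt
    have e1 : i' = 1 := by omega
    have e2 : m' = 1 := by omega
    rw [e1, e2] at him'
    exact hlast him'
  by_cases hij : i = j
  · have hmj : m = j := by
      rw [hij, h1] at him
      exact (hQ'.inj _ le_rfl _ hm him).symm
    exact hG.false_of_paths hP' hQ' (by omega) (by omega) h0 h1
      (fun s hs hlt t ht => hmin s hs (by omega) t ht) ⟨j, rfl⟩ (by omega)
  have hmj : m ≠ j := by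
    intro e
    rw [e, ← h1] at him
    exact hij (hP'.inj _ hia _ le_rfl him)
  have hii' : i ≤ j - i' := by
    by_contra hlt
    exact hmin' (j - i) (by omega) (by omega) (j - m) (by omega) (by
      rw [show j - (j - i) = i by omega, show j - (j - m) = m by omega]; exact him)
  obtain ⟨o1, l1⟩ := hP.lt_of_first_meeting hG hQ hj h0 hi hm1 hia hm him3 him
    (fun s hs hlt t ht => hmin s hs hlt t (by omega))
  obtain ⟨o2, l2⟩ := hP.reverse.lt_of_first_meeting hG hQ.reverse hj (by simpa using h1) hi' hm1'
    hia' hm' him3' him' (fun s hs hlt t ht => hmin' s hs hlt t (by omega))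
  -- The segments of `Q` in the two cycles overlap, `j - m' < m`, while those of `P` do not.
  have hlt : i < j - i' := by
    rcases hii'.lt_or_eq with h | h
    · exact h
    · rw [← h, him] at him'
      have := hQ'.inj _ hm _ (by omega) him'
      omega
  have hA := hP'.splice hQ' hia hm him (by
    intro s hs t ht hmt e
    rcases Nat.eq_zero_or_pos s with h | h
    · subst h
      rw [h0] at e
      have := hQ'.inj _ (by omega) _ ht e
      omega
    · exact hmin s h hs t ht e)
  have hB := hQ'.splice hP' (Nat.sub_le j m') (Nat.sub_le j i') him'.symm (by
    intro s hs t ht hmt e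
    rcases ht.lt_or_eq with h | h
    · refine hmin' (j - t) (by omega) (by omega) (j - s) (by omega) ?_
      rw [show j - (j - t) = t by omega, show j - (j - s) = s by omega]
      exact e.symm
    · rw [h, h1] at e
      have := hQ'.inj _ (by omega) _ (by omega) e
      omega)
  refine hG.false_of_paths hA hB (by omega) (by omega) (by simpa using h0) ?_ ?_ ?_ ?_
  · have e1 : (if i + (j - m) ≤ i then P (i + (j - m)) else Q (i + (j - m) - i + m)) = Q j := by
      split_ifs with h
      · have : m = j := by omega
        rw [show i + (j - m) = i by omega, him, this]
      · congr 1; omega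
    simp only [e1, if_neg (show ¬ j - m' + (j - (j - i')) ≤ j - m' by omega)]
    rw [← h1]; congr 1; omega
  · intro s hs hlt' t ht
    by_cases hsi : s ≤ i <;> by_cases htm : t ≤ j - m' <;> simp only [hsi, htm, if_true, if_false]
    · rcases hsi.lt_or_eq with h | h
      · exact hmin s hs h t (by omega)
      · intro e
        rw [h, him] at e
        have := hQ'.inj _ (by omega) _ (by omega) e
        omega
    · intro e
      have := hP'.inj _ (by omega) _ (by omega) e
      omega
    · intro e
      have := hQ'.inj _ (by omega) _ (by omega) e
      omega
    · intro e
      by_cases htj : t - (j - m') + (j - i') = j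
      · rw [htj, h1] at e
        have := hQ'.inj _ (by omega) _ (by omega) e
        omega
      · refine hmin' (j - (t - (j - m') + (j - i'))) (by omega) (by omega) (j - (s - i + m))
          (by omega) ?_
        rw [show j - (j - (t - (j - m') + (j - i'))) = t - (j - m') + (j - i') by omega,
          show j - (j - (s - i + m)) = s - i + m by omega]
        exact e.symm
  · rw [Nat.odd_iff] at o1 o2
    rw [Nat.even_iff]
    omega
  · omega

/-- An admissible walk of length at most `k` is determined by its length and its two ends. -/
theorem unique (hG : CycleFree (shortEvenLengths k) G) : ∀ {j : ℕ} {P Q : ℕ → V},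
    IsAdmissibleWalk G k P j → IsAdmissibleWalk G k Q j → j ≤ k → P 0 = Q 0 → P j = Q j →
    ∀ i ≤ j, P i = Q i := by
  intro j
  induction j with
  | zero =>
    intro P Q _ _ _ h0 _ i hi
    obtain rfl : i = 0 := by omega
    exact h0
  | succ j ih =>
    intro P Q hP hQ hj h0 h1
    by_cases hf : P 1 = Q 1
    · have := ih hP.shift hQ.shift (by omega) hf h1
      intro i hi
      rcases Nat.eq_zero_or_pos i with h | h
      · rw [h, h0]
      · have := this (i - 1) (by omega)
        simpa only [show i - 1 + 1 = i by omega] using this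
    by_cases hl : P j = Q j
    · have := ih (hP.mono (by omega)) (hQ.mono (by omega)) (by omega) h0 hl
      intro i hi
      rcases hi.lt_or_eq with h | h
      · exact this i (by omega)
      · rw [h, h1]
    · have hj1 : 1 ≤ j := by
        by_contra h
        obtain rfl : j = 0 := by omega
        exact hl h0
      exact (hP.false_of_ne_ends hG hQ hj (by omega) h0 h1 hf hl).elim

end IsAdmissibleWalk

/-! ### Counting admissible walks -/

/-- A doubly stochastic symmetric kernel with nearly uniform entries on a finite set `N`, vanishing
on the diagonal and on the graph of a given involution `τ` of `N`. -/
lemma exists_symmetric_stochastic_kernel {V : Type*} [DecidableEq V] (N : Finset V) (τ : V → V)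
    (hτ : ∀ u ∈ N, τ u ∈ N) (hinv : ∀ u ∈ N, τ (τ u) = u) (hd : 5 ≤ N.card) :
    ∃ T : V → V → ℝ, (∀ u ∈ N, ∀ w ∈ N, 0 ≤ T u w ∧ T u w ≤ 1 / ((N.card : ℝ) - 3)) ∧
      (∀ u ∈ N, T u u = 0 ∧ T u (τ u) = 0) ∧ (∀ u ∈ N, ∀ w ∈ N, T u w = T w u) ∧
      ∀ u ∈ N, ∑ w ∈ N, T u w = 1 := by
  set d : ℝ := (N.card : ℝ) with hdd
  have hd5 : (5 : ℝ) ≤ d := by rw [hdd]; exact_mod_cast hd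
  set a : ℕ := (N.filter fun w => τ w = w).card with ha
  -- It suffices to choose the entries for two, one or no fixed points of `τ` among the indices.
  suffices h : ∃ α β γ : ℝ, (0 ≤ α ∧ α ≤ 1 / (d - 3)) ∧ (0 ≤ β ∧ β ≤ 1 / (d - 3)) ∧
      (0 ≤ γ ∧ γ ≤ 1 / (d - 3)) ∧ (1 ≤ a → a * α + (d - a) * β - α = 1) ∧
      a * β + (d - a) * γ - 2 * γ = 1 by
    obtain ⟨α, β, γ, hα, hβ, hγ, h1, h2⟩ := h
    let S : V → V → ℝ := fun u w =>
      if τ u = u then (if τ w = w then α else β) else (if τ w = w then β else γ)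
    have hS : ∀ u w, 0 ≤ S u w ∧ S u w ≤ 1 / (d - 3) := by
      intro u w
      simp only [S]
      split_ifs <;> assumption
    have hSs : ∀ u w, S u w = S w u := by
      intro u w
      simp only [S]
      split_ifs <;> rfl
    refine ⟨fun u w => if w = u ∨ w = τ u then 0 else S u w, ?_, ?_, ?_, ?_⟩
    · intro u _ w _
      dsimp only
      split_ifs
      · exact ⟨le_rfl, by apply div_nonneg <;> linarith⟩
      · exact hS u w
    · intro u _
      simp
    · intro u hu w hw
      have : (w = u ∨ w = τ u) ↔ (u = w ∨ u = τ w) := by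
        constructor <;> rintro (rfl | rfl)
        · exact Or.inl rfl
        · exact Or.inr (hinv u hu).symm
        · exact Or.inl rfl
        · exact Or.inr (hinv w hw).symm
      simp only [this, hSs u w]
    · intro u hu
      have hrow : ∀ x y : ℝ, ∑ w ∈ N, (if τ w = w then x else y) = a * x + (d - a) * y := by
        intro x y
        have hc := Finset.card_filter_add_card_filter_not (s := N) (fun w => τ w = w)
        have hc' : ((N.filter fun w => ¬ τ w = w).card : ℝ) = d - a := by
          rw [hdd, ha, ← hc]; push_cast; ring
        rw [Finset.sum_ite, Finset.sum_const, Finset.sum_const, nsmul_eq_mul, nsmul_eq_mul, hc']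
      by_cases hf : τ u = u
      · have e : ∀ w, (if w = u ∨ w = τ u then 0 else S u w) =
            (if τ w = w then α else β) - (if w = u then α else 0) := by
          intro w
          by_cases hw : w = u
          · subst hw; simp [hf]
          · simp [hw, hf, S]
        simp only [e, Finset.sum_sub_distrib, hrow, Finset.sum_ite_eq', hu, if_true]
        exact h1 (Finset.card_pos.2 ⟨u, Finset.mem_filter.2 ⟨hu, hf⟩⟩)
      · have e : ∀ w, (if w = u ∨ w = τ u then 0 else S u w) =
            (if τ w = w then β else γ) - (if w = u then γ else 0) -
              (if w = τ u then γ else 0) := by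
          intro w
          by_cases hw : w = u
          · subst hw
            simp [hf, Ne.symm hf]
          · by_cases hw' : w = τ u
            · subst hw'
              simp [hw, hinv u hu, Ne.symm hf]
            · simp [hw, hw', hf, S]
        simp only [e, Finset.sum_sub_distrib, hrow, Finset.sum_ite_eq', hu, hτ u hu, if_true]
        linarith
  have hb1 : 0 < d - 1 := by linarith
  have hb2 : 0 < d - 2 := by linarith
  have hb3 : 0 < d - 3 := by linarith
  have hle1 : 1 / (d - 1) ≤ 1 / (d - 3) := one_div_le_one_div_of_le hb3 (by linarith)
  have hle2 : 1 / (d - 2) ≤ 1 / (d - 3) := one_div_le_one_div_of_le hb3 (by linarith)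
  by_cases ha1 : a = 1
  · refine ⟨0, 1 / (d - 1), (d - 2) / (d - 1) * (1 / (d - 3)), ⟨le_rfl, by positivity⟩,
      ⟨by positivity, hle1⟩, ⟨by positivity, ?_⟩, fun _ => ?_, ?_⟩
    · have : (d - 2) / (d - 1) ≤ 1 := by rw [div_le_one hb1]; linarith
      exact mul_le_of_le_one_left (by positivity) this
    · rw [ha1]; field_simp; push_cast; ring
    · rw [ha1]; field_simp; push_cast; ring
  · by_cases ha0 : a = 0
    · refine ⟨0, 1 / (d - 2), 1 / (d - 2), ⟨le_rfl, by positivity⟩, ⟨by positivity, hle2⟩,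
        ⟨by positivity, hle2⟩, fun h => by omega, ?_⟩
      rw [ha0]; field_simp; push_cast; ring
    · have ha2 : (2 : ℝ) ≤ a := by exact_mod_cast (by omega : 2 ≤ a)
      have hb4 : 0 < (a : ℝ) - 1 := by linarith
      refine ⟨((a : ℝ) - 2) / (a - 1) * (1 / (d - 2)), 1 / (d - 2), 1 / (d - 2),
        ⟨mul_nonneg (div_nonneg (by linarith) hb4.le) (by positivity), ?_⟩,
        ⟨by positivity, hle2⟩, ⟨by positivity, hle2⟩, fun _ => ?_, ?_⟩
      · have : ((a : ℝ) - 2) / (a - 1) ≤ 1 := by rw [div_le_one hb4]; linarith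
        exact (mul_le_of_le_one_left (by positivity) this).trans hle2
      · field_simp; ring
      · field_simp; ring

section Walks

variable {V : Type*} [Fintype V] {G : SimpleGraph V} {k : ℕ}

open scoped Classical in
/-- At every vertex `v` the uniform continuation of steps into `v` can be replaced by a nearly
uniform one that is admissible and still preserves the uniform distribution on directed edges. -/
lemma exists_admissible_kernel (hG : CycleFree (shortEvenLengths k) G)
    (hdeg : ∀ v, 5 ≤ G.degree v) :
    ∃ T : V → V → V → ℝ, ∀ v,
      (∀ u, G.Adj v u → ∀ w, G.Adj v w → 0 ≤ T v u w ∧ T v u w * ((G.degree v : ℝ) - 3) ≤ 1) ∧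
      (∀ u, G.Adj v u → ∀ w, G.Adj v w → T v u w ≠ 0 → Admissible G k u v w) ∧
      (∀ u, G.Adj v u → ∑ w ∈ G.neighborFinset v, T v u w = 1) ∧
      (∀ w, G.Adj v w → ∑ u ∈ G.neighborFinset v, T v u w = 1) := by
  suffices h : ∀ v, ∃ T : V → V → ℝ,
      (∀ u, G.Adj v u → ∀ w, G.Adj v w → 0 ≤ T u w ∧ T u w * ((G.degree v : ℝ) - 3) ≤ 1) ∧
      (∀ u, G.Adj v u → ∀ w, G.Adj v w → T u w ≠ 0 → Admissible G k u v w) ∧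
      (∀ u, G.Adj v u → ∑ w ∈ G.neighborFinset v, T u w = 1) ∧
      (∀ w, G.Adj v w → ∑ u ∈ G.neighborFinset v, T u w = 1) by
    choose T hT using h
    exact ⟨T, hT⟩
  intro v
  -- The partner of `u` is the other neighbour of `v` on the short odd cycle through `uv`, if any.
  let τ : V → V := fun u => if h : ∃ w, ShortOdd G k u v w then h.choose else u
  have hτ : ∀ u w, G.Adj v u → ShortOdd G k u v w → τ u = w := by
    intro u w hu h
    have hex : ∃ w, ShortOdd G k u v w := ⟨w, h⟩
    simp only [τ, dif_pos hex]
    exact hex.choose_spec.unique hG hu.symm h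
  have hτ' : ∀ u, (¬ ∃ w, ShortOdd G k u v w) → τ u = u := fun u h => by simp only [τ, dif_neg h]
  obtain ⟨T, h1, h2, h3, h4⟩ := exists_symmetric_stochastic_kernel (G.neighborFinset v) τ
    (by
      intro u hu
      rw [SimpleGraph.mem_neighborFinset] at *
      by_cases h : ∃ w, ShortOdd G k u v w
      · obtain ⟨w, hw⟩ := h
        rw [hτ u w hu hw]
        exact hw.adj
      · rwa [hτ' u h])
    (by
      intro u hu
      rw [SimpleGraph.mem_neighborFinset] at *
      by_cases h : ∃ w, ShortOdd G k u v w
      · obtain ⟨w, hw⟩ := h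
        rw [hτ u w hu hw]
        exact hτ w u hw.adj (hw.symm hu.symm)
      · rw [hτ' u h, hτ' u h])
    (by rw [SimpleGraph.card_neighborFinset_eq_degree]; exact hdeg v)
  simp only [SimpleGraph.mem_neighborFinset, SimpleGraph.card_neighborFinset_eq_degree] at h1 h2 h3 h4
  have hd : (0 : ℝ) < (G.degree v : ℝ) - 3 := by
    have : (5 : ℝ) ≤ G.degree v := by exact_mod_cast hdeg v
    linarith
  refine ⟨T, fun u hu w hw => ⟨(h1 u hu w hw).1, ?_⟩, fun u hu w hw hT => ⟨hw, ?_, ?_⟩, h4, ?_⟩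
  · have := (h1 u hu w hw).2
    rwa [le_div_iff₀ hd] at this
  · rintro rfl
    exact hT (h2 w hu).1
  · intro h
    apply hT
    rw [← hτ u w hu h]
    exact (h2 u hu).2
  · intro w hw
    rw [← h4 w hw]
    refine Finset.sum_congr rfl fun u hu => ?_
    rw [SimpleGraph.mem_neighborFinset] at hu
    exact h3 u hu w hw

/-- The sequence `u, P 0, P 1, …`. -/
def prepend {V : Type*} (u : V) (P : ℕ → V) : ℕ → V
  | 0 => u
  | i + 1 => P i

lemma prepend_injective {V : Type*} (u : V) : Function.Injective (prepend u) := by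
  intro P Q h
  funext i
  exact congrFun h (i + 1)

open scoped Classical in
/-- The walks of length `j + 1` that start with the step from `u` to `v` and continue admissibly, as
sequences that are constant from the index `j + 1` on. -/
noncomputable def admissibleWalks (G : SimpleGraph V) (k : ℕ) : ℕ → V → V → Finset (ℕ → V)
  | 0, u, v => {fun i => if i = 0 then u else v}
  | j + 1, u, v => (Finset.univ.filter (Admissible G k u v)).biUnion fun w =>
      (admissibleWalks G k j v w).image (prepend u)

lemma apply_of_mem_admissibleWalks {j : ℕ} : ∀ {u v : V} {P : ℕ → V},
    P ∈ admissibleWalks G k j u v → P 0 = u ∧ P 1 = v ∧ ∀ i, j + 1 ≤ i → P i = P (j + 1) := by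
  induction j with
  | zero =>
    intro u v P hP
    simp only [admissibleWalks, Finset.mem_singleton] at hP
    subst hP
    refine ⟨by simp, by simp, fun i hi => ?_⟩
    simp [show i ≠ 0 by omega]
  | succ j ih =>
    intro u v P hP
    simp only [admissibleWalks, Finset.mem_biUnion, Finset.mem_image] at hP
    obtain ⟨w, -, Q, hQ, rfl⟩ := hP
    obtain ⟨h0, h1, h2⟩ := ih hQ
    refine ⟨rfl, h0, fun i hi => ?_⟩
    obtain ⟨i, rfl⟩ : ∃ i', i = i' + 1 := ⟨i - 1, by omega⟩
    exact h2 i (by omega)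

lemma isAdmissibleWalk_of_mem {j : ℕ} : ∀ {u v : V} {P : ℕ → V}, G.Adj u v →
    P ∈ admissibleWalks G k j u v → IsAdmissibleWalk G k P (j + 1) := by
  induction j with
  | zero =>
    intro u v P huv hP
    obtain ⟨h0, h1, -⟩ := apply_of_mem_admissibleWalks hP
    refine ⟨fun i hi => ?_, fun i hi => by omega⟩
    obtain rfl : i = 0 := by omega
    rwa [h0, h1]
  | succ j ih =>
    intro u v P huv hP
    simp only [admissibleWalks, Finset.mem_biUnion, Finset.mem_image, Finset.mem_filter,
      Finset.mem_univ, true_and] at hP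
    obtain ⟨w, hw, Q, hQ, rfl⟩ := hP
    obtain ⟨h0, h1, -⟩ := apply_of_mem_admissibleWalks hQ
    have hQ' := ih hw.1 hQ
    refine ⟨fun i hi => ?_, fun i hi => ?_⟩
    · rcases i with _ | i
      · simpa [prepend, h0] using huv
      · exact hQ'.adj i (by omega)
    · rcases i with _ | i
      · simpa [prepend, h0, h1] using hw
      · exact hQ'.admissible i (by omega)

open scoped Classical in
lemma card_admissibleWalks_succ (j : ℕ) (u v : V) :
    (admissibleWalks G k (j + 1) u v).card =
      ∑ w ∈ Finset.univ.filter (Admissible G k u v), (admissibleWalks G k j v w).card := by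
  rw [admissibleWalks, Finset.card_biUnion]
  · refine Finset.sum_congr rfl fun w _ => ?_
    exact Finset.card_image_of_injective _ (prepend_injective u)
  · intro w _ w' _ hne
    rw [Function.onFun, Finset.disjoint_left]
    intro P hP hP'
    simp only [Finset.mem_image] at hP hP'
    obtain ⟨Q, hQ, rfl⟩ := hP
    obtain ⟨Q', hQ', h⟩ := hP'
    obtain rfl := prepend_injective u h
    exact hne ((apply_of_mem_admissibleWalks hQ).2.1.symm.trans
      (apply_of_mem_admissibleWalks hQ').2.1)

/-- Admissible walks of length `j + 1 ≤ k` from `u` are determined by their ends. -/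
lemma injOn_end_admissibleWalks (hG : CycleFree (shortEvenLengths k) G) {j : ℕ} (hj : j + 1 ≤ k)
    {u v v' : V} (huv : G.Adj u v) (huv' : G.Adj u v') {P P' : ℕ → V}
    (hP : P ∈ admissibleWalks G k j u v) (hP' : P' ∈ admissibleWalks G k j u v')
    (h : P (j + 1) = P' (j + 1)) : P = P' := by
  obtain ⟨h0, -, h2⟩ := apply_of_mem_admissibleWalks hP
  obtain ⟨h0', -, h2'⟩ := apply_of_mem_admissibleWalks hP'
  have key := (isAdmissibleWalk_of_mem huv hP).unique hG (isAdmissibleWalk_of_mem huv' hP') hj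
    (by rw [h0, h0']) h
  funext i
  rcases le_or_gt i (j + 1) with hi | hi
  · exact key i hi
  · rw [h2 i hi.le, h2' i hi.le, h]

open scoped Classical in
/-- The admissible walks of length `j + 1 ≤ k` from `u` all have different ends. -/
lemma sum_card_admissibleWalks_le (hG : CycleFree (shortEvenLengths k) G) {j : ℕ} (hj : j + 1 ≤ k)
    (u : V) (B : Finset V)
    (hB : ∀ v, G.Adj u v → ∀ P ∈ admissibleWalks G k j u v, P (j + 1) ∈ B) :
    ∑ v ∈ G.neighborFinset u, (admissibleWalks G k j u v).card ≤ B.card := by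
  rw [← Finset.card_biUnion]
  · refine Finset.card_le_card_of_injOn (fun P => P (j + 1)) ?_ ?_
    · intro P hP
      simp only [Finset.coe_biUnion, Set.mem_iUnion, Finset.mem_coe,
        SimpleGraph.mem_neighborFinset] at hP
      obtain ⟨v, hv, hP⟩ := hP
      exact hB v hv P hP
    · intro P hP P' hP' h
      simp only [Finset.coe_biUnion, Set.mem_iUnion, Finset.mem_coe,
        SimpleGraph.mem_neighborFinset] at hP hP'
      obtain ⟨v, hv, hP⟩ := hP
      obtain ⟨v', hv', hP'⟩ := hP'
      exact injOn_end_admissibleWalks hG hj hv hv' hP hP' h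
  · intro v _ v' _ hne
    rw [Function.onFun, Finset.disjoint_left]
    intro P hP hP'
    exact hne ((apply_of_mem_admissibleWalks hP).2.1.symm.trans
      (apply_of_mem_admissibleWalks hP').2.1)

end Walks

/-- Jensen's inequality for the logarithm, for weights of total mass `M`. -/
lemma sum_mul_log_le {ι : Type*} (s : Finset ι) (t X : ι → ℝ) {M : ℝ} (ht : ∀ i ∈ s, 0 ≤ t i)
    (hX : ∀ i ∈ s, 0 < X i) (hM : ∑ i ∈ s, t i = M) (hM0 : 0 < M) :
    ∑ i ∈ s, t i * Real.log (X i) ≤ M * Real.log ((∑ i ∈ s, t i * X i) / M) := by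
  have hpos : 0 < ∑ i ∈ s, t i * X i := by
    obtain ⟨i, hi, hti⟩ : ∃ i ∈ s, 0 < t i := by
      by_contra! h
      have := Finset.sum_nonpos h
      linarith
    exact Finset.sum_pos' (fun i hi => mul_nonneg (ht i hi) (hX i hi).le)
      ⟨i, hi, mul_pos hti (hX i hi)⟩
  set c := (∑ i ∈ s, t i * X i) / M with hc
  have hc0 : 0 < c := div_pos hpos hM0
  have h1 : ∀ i ∈ s, t i * Real.log (X i) ≤ t i * Real.log c + (t i * X i) / c - t i := by
    intro i hi
    have h2 := Real.log_le_sub_one_of_pos (div_pos (hX i hi) hc0)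
    rw [Real.log_div (hX i hi).ne' hc0.ne'] at h2
    have h3 := mul_le_mul_of_nonneg_left h2 (ht i hi)
    have e : t i * (X i / c - 1) = t i * X i / c - t i := by ring
    rw [e] at h3
    linarith [h3, mul_sub (t i) (Real.log (X i)) (Real.log c)]
  have h2 := Finset.sum_le_sum h1
  rw [Finset.sum_sub_distrib, Finset.sum_add_distrib, ← Finset.sum_mul, ← Finset.sum_div, hM] at h2
  have h3 : (∑ i ∈ s, t i * X i) / c = M := by
    rw [hc]; field_simp
  linarith

section Count

variable {V : Type*} [Fintype V] {G : SimpleGraph V} {k : ℕ}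

open scoped Classical in
lemma admissibleWalks_nonempty (hG : CycleFree (shortEvenLengths k) G)
    (hdeg : ∀ v, 5 ≤ G.degree v) (j : ℕ) :
    ∀ {u v : V}, G.Adj u v → 0 < (admissibleWalks G k j u v).card := by
  obtain ⟨T, hT⟩ := exists_admissible_kernel hG hdeg
  induction j with
  | zero => intro u v _; simp [admissibleWalks]
  | succ j ih =>
    intro u v huv
    rw [card_admissibleWalks_succ]
    obtain ⟨-, h2, h3, -⟩ := hT v
    obtain ⟨w, hw, hne⟩ := Finset.exists_ne_zero_of_sum_ne_zero
      (by rw [h3 u huv.symm]; exact one_ne_zero)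
    rw [SimpleGraph.mem_neighborFinset] at hw
    have hadm := h2 u huv.symm w hw hne
    exact Finset.sum_pos' (fun _ _ => Nat.zero_le _) ⟨w, by simpa using hadm, ih hadm.1⟩

open scoped Classical in
lemma sum_neighborFinset_comm (f : V → V → ℝ) :
    ∑ u, ∑ v ∈ G.neighborFinset u, f u v = ∑ v, ∑ u ∈ G.neighborFinset v, f u v :=
  Finset.sum_comm' fun u v => by
    simp only [Finset.mem_univ, SimpleGraph.mem_neighborFinset, true_and, and_true]
    exact G.adj_comm u v

open scoped Classical in
/-- The entropy step: extending a uniformly random admissible walk by the admissible kernel. -/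
lemma sum_log_card_admissibleWalks_succ (hG : CycleFree (shortEvenLengths k) G)
    (hdeg : ∀ v, 5 ≤ G.degree v) (j : ℕ) :
    ∑ v, (G.degree v : ℝ) * Real.log ((G.degree v : ℝ) - 3) +
        ∑ u, ∑ v ∈ G.neighborFinset u, Real.log (admissibleWalks G k j u v).card ≤
      ∑ u, ∑ v ∈ G.neighborFinset u, Real.log (admissibleWalks G k (j + 1) u v).card := by
  obtain ⟨T, hT⟩ := exists_admissible_kernel hG hdeg
  have hd : ∀ v, (0 : ℝ) < (G.degree v : ℝ) - 3 := by
    intro v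
    have : (5 : ℝ) ≤ G.degree v := by exact_mod_cast hdeg v
    linarith
  have hstep : ∀ u v, G.Adj u v → Real.log ((G.degree v : ℝ) - 3) +
      ∑ w ∈ G.neighborFinset v, T v u w * Real.log (admissibleWalks G k j v w).card ≤
        Real.log (admissibleWalks G k (j + 1) u v).card := by
    intro u v huv
    obtain ⟨h1, h2, h3, -⟩ := hT v
    have hpos : ∀ w ∈ G.neighborFinset v, (0 : ℝ) < (admissibleWalks G k j v w).card := by
      intro w hw
      rw [SimpleGraph.mem_neighborFinset] at hw
      exact_mod_cast admissibleWalks_nonempty hG hdeg j hw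
    have hJ := sum_mul_log_le (G.neighborFinset v) (T v u)
      (fun w => ((admissibleWalks G k j v w).card : ℝ) * ((G.degree v : ℝ) - 3))
      (fun w hw => (h1 u huv.symm w (by simpa using hw)).1)
      (fun w hw => mul_pos (hpos w hw) (hd v)) (h3 u huv.symm) one_pos
    have e1 : ∑ w ∈ G.neighborFinset v, T v u w *
        Real.log (((admissibleWalks G k j v w).card : ℝ) * ((G.degree v : ℝ) - 3)) =
        Real.log ((G.degree v : ℝ) - 3) +
          ∑ w ∈ G.neighborFinset v, T v u w * Real.log (admissibleWalks G k j v w).card := by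
      rw [← one_mul (Real.log ((G.degree v : ℝ) - 3)), ← h3 u huv.symm, Finset.sum_mul,
        ← Finset.sum_add_distrib]
      refine Finset.sum_congr rfl fun w hw => ?_
      rw [Real.log_mul (hpos w hw).ne' (hd v).ne']
      ring
    rw [e1, one_mul, div_one] at hJ
    refine hJ.trans (Real.log_le_log ?_ ?_)
    · obtain ⟨w, hw, hne⟩ := Finset.exists_ne_zero_of_sum_ne_zero
        (by rw [h3 u huv.symm]; exact one_ne_zero)
      refine Finset.sum_pos' (fun w hw => mul_nonneg (h1 u huv.symm w (by simpa using hw)).1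
        (mul_pos (hpos w hw) (hd v)).le) ⟨w, hw, mul_pos ?_ (mul_pos (hpos w hw) (hd v))⟩
      exact lt_of_le_of_ne (h1 u huv.symm w (by simpa using hw)).1 hne.symm
    · rw [card_admissibleWalks_succ, Nat.cast_sum]
      rw [← Finset.sum_filter_add_sum_filter_not (G.neighborFinset v) (Admissible G k u v),
        Finset.sum_eq_zero (s := (G.neighborFinset v).filter fun w => ¬ Admissible G k u v w),
        add_zero]
      · rw [show (G.neighborFinset v).filter (Admissible G k u v) =
          Finset.univ.filter (Admissible G k u v) by
            ext w
            simp only [Finset.mem_filter, SimpleGraph.mem_neighborFinset, Finset.mem_univ, true_and,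
              and_iff_right_iff_imp]
            exact fun h => h.1]
        refine Finset.sum_le_sum fun w hw => ?_
        have hw' : Admissible G k u v w := by simpa using hw
        have h4 := (h1 u huv.symm w hw'.1).2
        have h5 : (0 : ℝ) ≤ (admissibleWalks G k j v w).card := Nat.cast_nonneg _
        nlinarith
      · intro w hw
        simp only [Finset.mem_filter, SimpleGraph.mem_neighborFinset] at hw
        by_contra hne
        exact hw.2 (h2 u huv.symm w hw.1 (left_ne_zero_of_mul hne))
  refine le_trans (le_of_eq ?_) (Finset.sum_le_sum fun u _ => Finset.sum_le_sum fun v hv =>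
    hstep u v (by simpa using hv))
  simp only [Finset.sum_add_distrib]
  congr 1
  · rw [sum_neighborFinset_comm]
    refine Finset.sum_congr rfl fun v _ => ?_
    rw [Finset.sum_const, SimpleGraph.card_neighborFinset_eq_degree, nsmul_eq_mul]
  · rw [sum_neighborFinset_comm fun u v => ∑ w ∈ G.neighborFinset v,
      T v u w * Real.log (admissibleWalks G k j v w).card]
    refine Finset.sum_congr rfl fun v _ => ?_
    rw [Finset.sum_comm]
    refine Finset.sum_congr rfl fun w hw => ?_
    rw [← Finset.sum_mul, (hT v).2.2.2 w (by simpa using hw), one_mul]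

/-- By convexity of `x log x`, the sum over the degrees is at least its value for a regular graph,
up to the loss of a constant in the degree. -/
lemma mul_log_le_sum_degrees {ι : Type*} [Fintype ι] (d : ι → ℝ) (hd : ∀ i, 6 ≤ d i) {y : ℝ}
    (hy : 6 < y) (hsum : ∑ i, d i = Fintype.card ι * y) :
    (∑ i, d i) * Real.log (y - 6) ≤ ∑ i, d i * Real.log (d i - 3) := by
  have h1 : ∀ i, d i * Real.log y + d i - y - 6 ≤ d i * Real.log (d i - 3) := by
    intro i
    have hdi := hd i
    have h2 := Real.log_le_sub_one_of_pos (show 0 < d i / (d i - 3) by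
      apply div_pos <;> linarith)
    rw [Real.log_div (by linarith) (by linarith)] at h2
    have h3 := Real.log_le_sub_one_of_pos (show 0 < y / d i by apply div_pos <;> linarith)
    rw [Real.log_div (by linarith) (by linarith)] at h3
    have h4 : d i * (y / d i - 1) = y - d i := by
      have : d i ≠ 0 := by linarith
      field_simp
    have h5 : d i * (d i / (d i - 3) - 1) ≤ 6 := by
      have : 0 < d i - 3 := by linarith
      rw [show d i * (d i / (d i - 3) - 1) = 3 * d i / (d i - 3) by field_simp; ring, div_le_iff₀ this]
      linarith
    have h6 := mul_le_mul_of_nonneg_left h2 (show 0 ≤ d i by linarith)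
    have h7 := mul_le_mul_of_nonneg_left h3 (show 0 ≤ d i by linarith)
    nlinarith
  have h2 := Finset.sum_le_sum fun i (_ : i ∈ Finset.univ) => h1 i
  simp only [Finset.sum_sub_distrib, Finset.sum_add_distrib, ← Finset.sum_mul, Finset.sum_const,
    nsmul_eq_mul, Finset.card_univ] at h2
  have h3 := Real.log_le_sub_one_of_pos (show 0 < (y - 6) / y by apply div_pos <;> linarith)
  rw [Real.log_div (by linarith) (by linarith)] at h3
  have h4 : y * ((y - 6) / y - 1) = -6 := by
    have : y ≠ 0 := by linarith
    field_simp; ring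
  have h5 : (∑ i, d i) * Real.log (y - 6) ≤
      (∑ i, d i) * Real.log y + Fintype.card ι * (y * ((y - 6) / y - 1)) := by
    have h6 := mul_le_mul_of_nonneg_left h3 (show 0 ≤ ∑ i, d i from
      Finset.sum_nonneg fun i _ => by linarith [hd i])
    rw [hsum] at h6 ⊢
    nlinarith
  rw [h4] at h5
  linarith

open scoped Classical in
/-- A graph of minimum degree at least `7` without short even cycles has average degree at most
`n ^ (1 / k) + 6`: it has at least `n (d - 6) ^ k` admissible walks of length `k`. -/
lemma average_degree_sub_pow_le (hk : 1 ≤ k) (hG : CycleFree (shortEvenLengths k) G)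
    (hdeg : ∀ v, 7 ≤ G.degree v) [Nonempty V] {y : ℝ}
    (hy : ∑ v, (G.degree v : ℝ) = Fintype.card V * y) :
    6 < y ∧ (y - 6) ^ k ≤ Fintype.card V := by
  have hn : (0 : ℝ) < Fintype.card V := by exact_mod_cast Fintype.card_pos
  have hd7 : ∀ v, (7 : ℝ) ≤ G.degree v := fun v => by exact_mod_cast hdeg v
  have hy6 : 6 < y := by
    have h1 := Finset.sum_le_sum fun v (_ : v ∈ Finset.univ) => hd7 v
    rw [hy, Finset.sum_const, nsmul_eq_mul, Finset.card_univ] at h1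
    have := le_of_mul_le_mul_left h1 hn
    linarith
  refine ⟨hy6, ?_⟩
  set M : ℝ := ∑ v, (G.degree v : ℝ) with hM
  have hM0 : 0 < M := by rw [hy]; positivity
  have hlog : ∀ j : ℕ, j * (M * Real.log (y - 6)) ≤
      ∑ u, ∑ v ∈ G.neighborFinset u, Real.log (admissibleWalks G k j u v).card := by
    intro j
    induction j with
    | zero => simp [admissibleWalks]
    | succ j ih =>
      have h1 := sum_log_card_admissibleWalks_succ hG (fun v => le_trans (by norm_num) (hdeg v)) j
      have h2 := mul_log_le_sum_degrees (fun v => (G.degree v : ℝ))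
        (fun v => le_trans (by norm_num) (hd7 v)) hy6 hy
      push_cast
      linarith
  obtain ⟨j, rfl⟩ : ∃ j, k = j + 1 := ⟨k - 1, by omega⟩
  have hJ := sum_mul_log_le (Finset.univ.sigma fun u => G.neighborFinset u) (fun _ => (1 : ℝ))
    (fun p => ((admissibleWalks G (j + 1) j p.1 p.2).card : ℝ)) (fun _ _ => zero_le_one)
    (by
      intro p hp
      simp only [Finset.mem_sigma, SimpleGraph.mem_neighborFinset, Finset.mem_univ, true_and] at hp
      exact_mod_cast admissibleWalks_nonempty hG (fun v => le_trans (by norm_num) (hdeg v)) j hp)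
    (M := M) (by simp [hM]) hM0
  simp only [one_mul, Finset.sum_sigma] at hJ
  have h1 := (hlog j).trans hJ
  have hle : ∑ u, ∑ v ∈ G.neighborFinset u, ((admissibleWalks G (j + 1) j u v).card : ℝ) ≤
      Fintype.card V * Fintype.card V := by
    have : ∀ u ∈ Finset.univ, ∑ v ∈ G.neighborFinset u,
        ((admissibleWalks G (j + 1) j u v).card : ℝ) ≤ Fintype.card V := by
      intro u _
      exact_mod_cast sum_card_admissibleWalks_le hG le_rfl u Finset.univ
        (fun _ _ _ _ => Finset.mem_univ _)
    refine (Finset.sum_le_sum this).trans ?_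
    simp
  set W := ∑ u, ∑ v ∈ G.neighborFinset u, ((admissibleWalks G (j + 1) j u v).card : ℝ)
  have hW : 0 < W := by
    obtain ⟨u⟩ := ‹Nonempty V›
    refine Finset.sum_pos' (fun u _ => Finset.sum_nonneg fun v _ => Nat.cast_nonneg _)
      ⟨u, Finset.mem_univ _, ?_⟩
    refine Finset.sum_pos (fun v hv => ?_) ?_
    · exact_mod_cast admissibleWalks_nonempty hG (fun v => le_trans (by norm_num) (hdeg v)) j
        (by simpa using hv)
    · rw [← Finset.card_pos, SimpleGraph.card_neighborFinset_eq_degree]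
      exact lt_of_lt_of_le (by norm_num) (hdeg u)
  have h2 : (j : ℝ) * Real.log (y - 6) ≤ Real.log (W / M) := by
    refine le_of_mul_le_mul_left ?_ hM0
    linarith
  rw [← Real.log_pow, Real.log_le_log_iff (pow_pos (by linarith) _) (div_pos hW hM0),
    le_div_iff₀ hM0] at h2
  have h3 : (Fintype.card V : ℝ) * (y - 6) ^ (j + 1) ≤ Fintype.card V * Fintype.card V := by
    calc (Fintype.card V : ℝ) * (y - 6) ^ (j + 1)
        = (y - 6) ^ j * (Fintype.card V * (y - 6)) := by ring
      _ ≤ (y - 6) ^ j * (Fintype.card V * y) := by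
          have : 0 ≤ (y - 6) ^ j := pow_nonneg (by linarith) _
          gcongr
          linarith
      _ ≤ W := by rw [← hy]; exact h2
      _ ≤ _ := hle
  exact le_of_mul_le_mul_left h3 hn

end Count

/-! ### The upper bound for the extremal number -/

lemma CycleFree.of_isContained {V W : Type*} {S : Set ℕ} {G : SimpleGraph V} {H : SimpleGraph W}
    (hG : CycleFree S G) (h : H.IsContained G) : CycleFree S H :=
  fun l hl hc => hG l hl (hc.trans h)

open scoped Classical in
lemma card_edgeFinset_le_of_le_degree {V : Type*} [Fintype V] {G : SimpleGraph V} {k : ℕ}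
    (hk : 1 ≤ k) (hG : CycleFree (shortEvenLengths k) G) (hdeg : ∀ v, 7 ≤ G.degree v) :
    (G.edgeFinset.card : ℝ) ≤
      1 / 2 * (Fintype.card V : ℝ) ^ (1 + 1 / (k : ℝ)) + 3 * Fintype.card V := by
  rcases isEmpty_or_nonempty V with hV | hV
  · have : G.edgeFinset.card ≤ (Fintype.card V).choose 2 := G.card_edgeFinset_le_card_choose_two
    rw [Fintype.card_eq_zero] at this ⊢
    have h0 : G.edgeFinset.card = 0 := by simpa using this
    rw [h0, Nat.cast_zero]
    positivity
  have hn : (0 : ℝ) < Fintype.card V := by exact_mod_cast Fintype.card_pos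
  have hsum : ∑ v, (G.degree v : ℝ) = 2 * G.edgeFinset.card := by
    exact_mod_cast G.sum_degrees_eq_twice_card_edges
  set y : ℝ := (∑ v, (G.degree v : ℝ)) / Fintype.card V with hy
  have hy' : ∑ v, (G.degree v : ℝ) = Fintype.card V * y := by rw [hy]; field_simp
  obtain ⟨hy6, hpow⟩ := average_degree_sub_pow_le hk hG hdeg hy'
  have hroot : y - 6 ≤ (Fintype.card V : ℝ) ^ (1 / (k : ℝ)) := by
    have h1 := Real.rpow_le_rpow (pow_nonneg (by linarith) k) hpow
      (show (0 : ℝ) ≤ 1 / (k : ℝ) by positivity)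
    rwa [one_div, Real.pow_rpow_inv_natCast (by linarith) (by omega), ← one_div] at h1
  rw [Real.rpow_add hn, Real.rpow_one]
  rw [hsum] at hy'
  nlinarith

open scoped Classical in
/-- Vertices of degree less than `7` can be deleted one by one, at the cost of the linear
term. -/
theorem card_edgeFinset_le_of_cycleFree {k : ℕ} (hk : 2 ≤ k) (n : ℕ) :
    ∀ {V : Type} [Fintype V] (G : SimpleGraph V), Fintype.card V = n →
      CycleFree (shortEvenLengths k) G → (G.edgeFinset.card : ℝ) ≤
        1 / 2 * (n : ℝ) ^ (1 + 1 / (k : ℝ)) + 2 ^ (k ^ 2) * (n : ℝ) := by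
  have h16 : 2 ^ (2 ^ 2) ≤ 2 ^ (k ^ 2) :=
    Nat.pow_le_pow_right (by norm_num) (Nat.pow_le_pow_left hk 2)
  induction n with
  | zero =>
    intro V _ G hn hG
    have : G.edgeFinset.card ≤ (Fintype.card V).choose 2 := G.card_edgeFinset_le_card_choose_two
    rw [hn] at this
    have h0 : G.edgeFinset.card = 0 := by simpa using this
    rw [h0, Nat.cast_zero]
    positivity
  | succ n ih =>
    intro V _ G hn hG
    by_cases hdeg : ∀ v, 7 ≤ G.degree v
    · have h := card_edgeFinset_le_of_le_degree (by omega) hG hdeg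
      rw [hn] at h
      refine h.trans ?_
      have : (3 : ℝ) ≤ 2 ^ (k ^ 2) := by exact_mod_cast (by omega : 3 ≤ 2 ^ (k ^ 2))
      gcongr
    · push Not at hdeg
      obtain ⟨v, hv⟩ := hdeg
      have hcard : Fintype.card ({v}ᶜ : Set V) = n := by
        rw [Fintype.card_compl_set, hn]; simp
      have h1 : ((G.induce ({v}ᶜ : Set V)).edgeFinset.card : ℝ) ≤
          1 / 2 * (n : ℝ) ^ (1 + 1 / (k : ℝ)) + 2 ^ (k ^ 2) * (n : ℝ) := by
        convert ih (G.induce ({v}ᶜ : Set V)) hcard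
          (hG.of_isContained ⟨SimpleGraph.Copy.induce G _⟩)
      have h2 : G.edgeFinset.card = (G.induce ({v}ᶜ : Set V)).edgeFinset.card + G.degree v := by
        have h3 := G.card_edgeFinset_induce_compl_singleton v
        rw [G.card_edgeFinset_deleteIncidenceSet v] at h3
        have h4 : G.degree v ≤ G.edgeFinset.card := G.degree_le_card_edgeFinset v
        omega
      rw [h2]
      have h5 : (G.degree v : ℝ) ≤ 2 ^ (k ^ 2) := by
        exact_mod_cast (by omega : G.degree v ≤ 2 ^ (k ^ 2))
      have h6 : (n : ℝ) ^ (1 + 1 / (k : ℝ)) ≤ ((n + 1 : ℕ) : ℝ) ^ (1 + 1 / (k : ℝ)) :=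
        Real.rpow_le_rpow (by positivity) (by push_cast; linarith) (by positivity)
      push_cast at h6 ⊢
      linarith

theorem exCycles_le {k : ℕ} (hk : 2 ≤ k) (n : ℕ) :
    (exCycles n (shortEvenLengths k) : ℝ) ≤
      1 / 2 * (n : ℝ) ^ (1 + 1 / (k : ℝ)) + 2 ^ (k ^ 2) * (n : ℝ) := by
  classical
  have h : exCycles n (shortEvenLengths k) ≤
      ⌊1 / 2 * (n : ℝ) ^ (1 + 1 / (k : ℝ)) + 2 ^ (k ^ 2) * (n : ℝ)⌋₊ := by
    refine Finset.sup_le fun G hG => Nat.le_floor ?_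
    rw [Finset.mem_filter] at hG
    convert card_edgeFinset_le_of_cycleFree hk n G (Fintype.card_fin n) hG.2
  exact (Nat.le_floor_iff (by positivity)).1 h

/-! ### Polarity graphs of generalized polygons -/

section Incidence

variable {P L : Type*} {I : P → L → Prop}

@[simp] lemma incidenceGraph_adj_inl_inr {p : P} {l : L} :
    (incidenceGraph I).Adj (Sum.inl p) (Sum.inr l) ↔ I p l := Iff.rfl

@[simp] lemma incidenceGraph_adj_inr_inl {p : P} {l : L} :
    (incidenceGraph I).Adj (Sum.inr l) (Sum.inl p) ↔ I p l := Iff.rfl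

@[simp] lemma not_incidenceGraph_adj_inl_inl {p p' : P} :
    ¬ (incidenceGraph I).Adj (Sum.inl p) (Sum.inl p') := id

@[simp] lemma not_incidenceGraph_adj_inr_inr {l l' : L} :
    ¬ (incidenceGraph I).Adj (Sum.inr l) (Sum.inr l') := id

/-- The bipartition of the incidence graph into points and lines. -/
def incidenceColoring (I : P → L → Prop) : (incidenceGraph I).Coloring Bool :=
  SimpleGraph.Coloring.mk Sum.isLeft fun {u v} h => by
    rcases u with p | l <;> rcases v with p' | l'
    · exact h.elim
    · simp
    · simp
    · exact h.elim

lemma not_cycleGraph_isContained_incidenceGraph {m : ℕ} (h : IsGeneralizedPolygon I m) {n : ℕ}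
    (hn : 3 ≤ n) (hnm : n < 2 * m) : ¬ (SimpleGraph.cycleGraph n).IsContained (incidenceGraph I) := by
  intro hc
  obtain ⟨v, p, hp, hpn⟩ := (SimpleGraph.cycleGraph_isContained_iff (by omega)).1 hc
  have := SimpleGraph.egirth_le_length hp
  rw [h.egirth_eq, hpn] at this
  have := Nat.cast_le.1 this
  omega

/-- An even cycle of the polarity graph becomes a cycle of the same length in the incidence graph
when every other vertex is replaced by its polar line. -/
lemma cycleFree_polarityGraph {m : ℕ} (h : IsGeneralizedPolygon I m) (π : Polarity I) {k : ℕ}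
    (hk : k < m) : CycleFree (shortEvenLengths k) π.graph := by
  rintro n ⟨hev, h4, hle⟩ ⟨f⟩
  refine not_cycleGraph_isContained_incidenceGraph h (n := n) (by omega) (by omega) ?_
  have hpar : ∀ u v : Fin n, (u - v).val = 1 → (Even u.val ↔ ¬ Even v.val) := by
    intro u v huv
    rw [Nat.even_iff] at hev
    rw [Nat.even_iff, Nat.even_iff]
    rcases le_or_gt v u with h' | h'
    · rw [Fin.sub_val_of_le h'] at huv
      have := Fin.le_def.1 h'
      omega
    · rw [Fin.coe_sub_iff_lt.mpr h'] at huv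
      omega
  have key : ∀ u v : Fin n, Even u.val → ¬ Even v.val → (SimpleGraph.cycleGraph n).Adj u v →
      I (f u) (π.toLine (f v)) := fun u v _ _ h => (f.toHom.map_adj h).2
  refine ⟨⟨⟨fun i => if Even i.val then Sum.inl (f i) else Sum.inr (π.toLine (f i)), ?_⟩, ?_⟩⟩
  · intro u v huv
    have hp : Even u.val ↔ ¬ Even v.val := by
      rcases SimpleGraph.cycleGraph_adj'.1 huv with h | h
      · exact hpar u v h
      · have := hpar v u h
        tauto
    by_cases hu : Even u.val
    · have hv := hp.1 hu
      rw [if_pos hu, if_neg hv]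
      exact key u v hu hv huv
    · have hv : Even v.val := by tauto
      rw [if_neg hu, if_pos hv]
      exact key v u hv hu huv.symm
  · intro u v huv
    simp only [RelHom.coeFn_mk] at huv
    split_ifs at huv
    · exact f.injective (Sum.inl_injective huv)
    · exact f.injective (π.toLine.injective (Sum.inr_injective huv))

lemma ncard_neighborSet_incidenceGraph {q : ℕ} (h : HasOrder I q) (v : P ⊕ L) :
    ((incidenceGraph I).neighborSet v).ncard = q + 1 := by
  rcases v with p | l
  · rw [← h.lines_through_point p,
      ← Set.ncard_image_of_injective {l | I p l} (Sum.inr_injective (α := P))]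
    refine congrArg Set.ncard (Set.ext ?_)
    rintro (x | x) <;> simp
  · rw [← h.points_on_line l,
      ← Set.ncard_image_of_injective {p | I p l} (Sum.inl_injective (β := L))]
    refine congrArg Set.ncard (Set.ext ?_)
    rintro (x | x) <;> simp

end Incidence

/-- In a graph of maximum degree `d` there are at most `d ^ j` ends of walks of length `j` that
start at a given vertex. -/
lemma exists_finset_of_walks {V : Type*} [Finite V] {G : SimpleGraph V} {d : ℕ}
    (hd : ∀ v, (G.neighborSet v).ncard ≤ d) (u : V) (j : ℕ) :
    ∃ B : Finset V, B.card ≤ d ^ j ∧ ∀ (z : V) (w : G.Walk z u), w.length = j → z ∈ B := by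
  classical
  have := Fintype.ofFinite V
  induction j with
  | zero =>
    refine ⟨{u}, by simp, fun z w hw => ?_⟩
    rw [Finset.mem_singleton]
    exact SimpleGraph.Walk.eq_of_length_eq_zero hw
  | succ j ih =>
    obtain ⟨B, hB, hB'⟩ := ih
    refine ⟨B.biUnion fun z => G.neighborFinset z, ?_, fun z w hw => ?_⟩
    · rw [pow_succ]
      refine (Finset.card_biUnion_le_card_mul _ _ d fun z _ => ?_).trans (Nat.mul_le_mul_right _ hB)
      have := hd z
      rwa [Set.ncard_eq_toFinset_card'] at this
    · cases w with
      | nil => simp at hw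
      | cons hadj w' =>
        rw [Finset.mem_biUnion]
        exact ⟨_, hB' _ w' (by simpa using hw), by simpa using hadj.symm⟩

/-- A vertex of the polarity graph has degree `q` or `q + 1`, depending on whether it is incident
with its polar line. -/
lemma card_edgeSet_polarityGraph_bounds {P L : Type*} [Finite P] {I : P → L → Prop}
    {q : ℕ} (hq : HasOrder I q) (π : Polarity I) :
    q * Nat.card P ≤ 2 * π.graph.edgeSet.ncard ∧
      2 * π.graph.edgeSet.ncard ≤ (q + 1) * Nat.card P := by
  classical
  have := Fintype.ofFinite P
  have hsum : ∑ p, π.graph.degree p = 2 * π.graph.edgeSet.ncard := by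
    rw [π.graph.sum_degrees_eq_twice_card_edges, Set.ncard_eq_toFinset_card']
    rfl
  have hdeg : ∀ p, q ≤ π.graph.degree p ∧ π.graph.degree p ≤ q + 1 := by
    intro p
    have h1 : {p' : P | I p (π.toLine p')}.ncard = q + 1 := by
      rw [← hq.lines_through_point p, ← Set.ncard_image_of_injective _ π.toLine.injective]
      congr 1
      ext l
      constructor
      · rintro ⟨p', hp', rfl⟩
        exact hp'
      · intro hl
        exact ⟨π.toLine.symm l, by simpa using hl, by simp⟩
    have h2 : π.graph.degree p = ({p' : P | I p (π.toLine p')} \ {p}).ncard := by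
      rw [← SimpleGraph.card_neighborFinset_eq_degree, SimpleGraph.neighborFinset,
        ← Set.ncard_eq_toFinset_card']
      congr 1
      ext p'
      simp only [SimpleGraph.mem_neighborSet, Polarity.graph, Set.mem_sdiff, Set.mem_ofPred_eq,
        Set.mem_singleton_iff]
      tauto
    rw [h2, ← h1]
    refine ⟨?_, Set.ncard_le_ncard Set.sdiff_subset⟩
    have := Set.ncard_le_ncard_sdiff_add_ncard {p' : P | I p (π.toLine p')} {p}
    rw [Set.ncard_singleton] at this
    omega
  rw [← hsum, Nat.card_eq_fintype_card, ← Finset.card_univ, mul_comm, mul_comm (q + 1)]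
  exact ⟨Finset.card_nsmul_le_sum _ _ _ fun p _ => (hdeg p).1,
    Finset.sum_le_card_nsmul _ _ _ fun p _ => (hdeg p).2⟩

section Order

variable {P L : Type*} [Finite P] [Finite L] {I : P → L → Prop} {k q : ℕ}

/-- The non-backtracking walks of length `k` from a point have different ends. -/
lemma pow_le_card_points (hk : 1 ≤ k) (h : IsGeneralizedPolygon I (k + 1)) (hq : HasOrder I q)
    (hPL : Nat.card P = Nat.card L) (p : P) : q ^ k ≤ Nat.card P := by
  classical
  have := Fintype.ofFinite P
  have := Fintype.ofFinite L
  have hG : CycleFree (shortEvenLengths k) (incidenceGraph I) := fun n hn =>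
    not_cycleGraph_isContained_incidenceGraph h (by have := hn.2.1; omega)
      (by have := hn.2.2; omega)
  have hodd : ∀ u v w, (incidenceGraph I).Adj u v → ¬ ShortOdd (incidenceGraph I) k u v w := by
    rintro u v w huv ⟨a, R, -, h2, hak, hR, rfl, rfl, rfl⟩
    exact not_cycleGraph_isContained_incidenceGraph h (n := a + 1) (by omega) (by omega)
      (cycleGraph_isContained_of_closed (by omega)
        (fun i hi j hj => hR.inj i (by omega) j (by omega)) (fun i hi => hR.adj i (by omega)) huv)
  have hdeg : ∀ v, ((incidenceGraph I).neighborFinset v).card = q + 1 := by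
    intro v
    rw [← ncard_neighborSet_incidenceGraph hq v, Set.ncard_eq_toFinset_card']
    rfl
  have hcard : ∀ j u v, (incidenceGraph I).Adj u v →
      q ^ j ≤ (admissibleWalks (incidenceGraph I) k j u v).card := by
    intro j
    induction j with
    | zero => intro u v _; simp [admissibleWalks]
    | succ j ih =>
      intro u v huv
      rw [card_admissibleWalks_succ, pow_succ']
      have hf : Finset.univ.filter (Admissible (incidenceGraph I) k u v) =
          ((incidenceGraph I).neighborFinset v).erase u := by
        ext w
        simp only [Finset.mem_filter, Finset.mem_univ, true_and, Finset.mem_erase,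
          SimpleGraph.mem_neighborFinset]
        exact ⟨fun hw => ⟨hw.2.1, hw.1⟩, fun hw => ⟨hw.2, hw.1, hodd u v w huv⟩⟩
      have hc : (((incidenceGraph I).neighborFinset v).erase u).card = q := by
        rw [Finset.card_erase_of_mem (by simpa using huv.symm), hdeg]
        rfl
      rw [hf]
      refine le_trans (le_of_eq ?_) (Finset.card_nsmul_le_sum _ _ (q ^ j) fun w hw => ih v w ?_)
      · rw [hc, smul_eq_mul]
      · simpa using (Finset.mem_erase.1 hw).2
  obtain ⟨j, rfl⟩ : ∃ j, k = j + 1 := ⟨k - 1, by omega⟩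
  have hend : ∀ v, (incidenceGraph I).Adj (Sum.inl p) v →
      ∀ W ∈ admissibleWalks (incidenceGraph I) (j + 1) j (Sum.inl p) v, W (j + 1) ∈
        Finset.univ.filter fun z : P ⊕ L => (z.isLeft = true ↔ Even (j + 1)) := by
    intro v hv W hW
    have hW' := isAdmissibleWalk_of_mem hv hW
    have : ∀ i ≤ j + 1, ((W i).isLeft = true ↔ Even i) := by
      intro i
      induction i with
      | zero => intro _; simp [(apply_of_mem_admissibleWalks hW).1]
      | succ i ih =>
        intro hi
        have h1 : (W i).isLeft ≠ (W (i + 1)).isLeft :=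
          (incidenceColoring I).valid (hW'.adj i (by omega))
        have h2 := ih (by omega)
        rw [Nat.even_add_one, ← h2]
        cases hx : (W i).isLeft <;> cases hy : (W (i + 1)).isLeft <;> simp_all
    simpa using this (j + 1) le_rfl
  have h1 := sum_card_admissibleWalks_le hG le_rfl (Sum.inl p) _ hend
  have h2 : (Finset.univ.filter fun z : P ⊕ L => (z.isLeft = true ↔ Even (j + 1))).card =
      Nat.card P := by
    by_cases he : Even (j + 1)
    · rw [Nat.card_eq_fintype_card, ← Finset.card_univ,
        ← Finset.card_map (s := (Finset.univ : Finset P)) Function.Embedding.inl]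
      refine congrArg Finset.card (Finset.ext ?_)
      rintro (x | x) <;> simp [he]
    · rw [hPL, Nat.card_eq_fintype_card, ← Finset.card_univ,
        ← Finset.card_map (s := (Finset.univ : Finset L)) Function.Embedding.inr]
      refine congrArg Finset.card (Finset.ext ?_)
      rintro (x | x) <;> simp [he]
  rw [h2] at h1
  refine le_trans ?_ h1
  refine le_trans ?_ (Finset.card_nsmul_le_sum _ _ (q ^ j) fun v hv =>
    hcard j _ v (by simpa using hv))
  rw [hdeg, smul_eq_mul, pow_succ']
  exact Nat.mul_le_mul_right _ (Nat.le_succ q)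

/-- By the parity of the distances, the points, or else the lines, are all within distance `k` of a
given point. -/
lemma card_points_le_pow (h : IsGeneralizedPolygon I (k + 1)) (hq : HasOrder I q)
    (hPL : Nat.card P = Nat.card L) (p : P) : Nat.card P ≤ (q + 1) ^ k := by
  classical
  have := Fintype.ofFinite P
  have := Fintype.ofFinite L
  obtain ⟨B, hB, hB'⟩ := exists_finset_of_walks (G := incidenceGraph I)
    (fun v => (ncard_neighborSet_incidenceGraph hq v).le) (Sum.inl p) k
  have hext : ∀ (z : P ⊕ L) (t : ℕ) (w : (incidenceGraph I).Walk z (Sum.inl p)),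
      ∃ w' : (incidenceGraph I).Walk z (Sum.inl p), w'.length = w.length + 2 * t := by
    intro z t w
    induction t with
    | zero => exact ⟨w, rfl⟩
    | succ t ih =>
      obtain ⟨w', hw'⟩ := ih
      obtain ⟨y, hy⟩ : ((incidenceGraph I).neighborSet z).Nonempty := by
        rw [← Set.ncard_pos, ncard_neighborSet_incidenceGraph hq]
        omega
      rw [SimpleGraph.mem_neighborSet] at hy
      refine ⟨SimpleGraph.Walk.cons hy (SimpleGraph.Walk.cons hy.symm w'), ?_⟩
      simp only [SimpleGraph.Walk.length_cons, hw']
      omega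
  have hmem : ∀ z : P ⊕ L, (z.isLeft = true ↔ Even k) → z ∈ B := by
    intro z hz
    have hd : (incidenceGraph I).edist z (Sum.inl p) ≤ ((k + 1 : ℕ) : ℕ∞) := by
      rw [← h.ediam_eq]
      exact SimpleGraph.edist_le_ediam
    obtain ⟨w, hw⟩ := SimpleGraph.exists_walk_of_edist_ne_top
      (ne_top_of_le_ne_top (ENat.natCast_ne_top _) hd)
    rw [← hw] at hd
    have hwk : w.length ≤ k + 1 := Nat.cast_le.1 hd
    have hpar : Even w.length ↔ (z.isLeft = true ↔ true = true) :=
      (incidenceColoring I).even_length_iff_congr w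
    have hpar' : Even w.length ↔ Even k := by rw [hpar, hz, eq_self, iff_true]
    rw [Nat.even_iff, Nat.even_iff] at hpar'
    obtain ⟨w', hw'⟩ := hext z ((k - w.length) / 2) w
    exact hB' z w' (by omega)
  refine le_trans ?_ hB
  by_cases hk : Even k
  · rw [Nat.card_eq_fintype_card, ← Finset.card_univ, ← Finset.card_map Function.Embedding.inl]
    refine Finset.card_le_card fun z hz => ?_
    obtain ⟨x, -, rfl⟩ := Finset.mem_map.1 hz
    exact hmem _ (by simpa using hk)
  · rw [hPL, Nat.card_eq_fintype_card, ← Finset.card_univ,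
      ← Finset.card_map Function.Embedding.inr]
    refine Finset.card_le_card fun z hz => ?_
    obtain ⟨x, -, rfl⟩ := Finset.mem_map.1 hz
    exact hmem _ (by simpa using hk)

theorem abs_card_edgeSet_polarityGraph_sub_le (hk : 1 ≤ k) (h : IsGeneralizedPolygon I (k + 1))
    (hq : HasOrder I q) (π : Polarity I) :
    |(π.graph.edgeSet.ncard : ℝ) - 1 / 2 * (Nat.card P : ℝ) ^ (1 + 1 / (k : ℝ))| ≤
      1 / 2 * (Nat.card P : ℝ) := by
  obtain ⟨hl, hu⟩ := card_edgeSet_polarityGraph_bounds hq π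
  have hl' : (q : ℝ) * Nat.card P ≤ 2 * π.graph.edgeSet.ncard := by exact_mod_cast hl
  have hu' : 2 * (π.graph.edgeSet.ncard : ℝ) ≤ (q + 1) * Nat.card P := by exact_mod_cast hu
  have hk0 : (0 : ℝ) < k := by exact_mod_cast hk
  rcases isEmpty_or_nonempty P with hP | ⟨⟨p⟩⟩
  · rw [Nat.card_of_isEmpty] at *
    have h0 : π.graph.edgeSet.ncard = 0 := by simpa using hu
    rw [h0, Nat.cast_zero, Real.zero_rpow (by positivity)]
    simp
  have hPL : Nat.card P = Nat.card L := Nat.card_congr π.toLine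
  have hn : (0 : ℝ) < Nat.card P := by
    have : Nonempty P := ⟨p⟩
    exact_mod_cast Nat.card_pos
  have h1 : (q : ℝ) ≤ (Nat.card P : ℝ) ^ (1 / (k : ℝ)) := by
    have h2 := Real.rpow_le_rpow (by positivity)
      (show ((q : ℝ) ^ k) ≤ Nat.card P by exact_mod_cast pow_le_card_points hk h hq hPL p)
      (show (0 : ℝ) ≤ 1 / (k : ℝ) by positivity)
    rwa [one_div, Real.pow_rpow_inv_natCast (by positivity) (by omega), ← one_div] at h2
  have h1' : (Nat.card P : ℝ) ^ (1 / (k : ℝ)) ≤ q + 1 := by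
    have h2 := Real.rpow_le_rpow (by positivity)
      (show (Nat.card P : ℝ) ≤ ((q : ℝ) + 1) ^ k by exact_mod_cast card_points_le_pow h hq hPL p)
      (show (0 : ℝ) ≤ 1 / (k : ℝ) by positivity)
    rwa [one_div, Real.pow_rpow_inv_natCast (by positivity) (by omega), ← one_div] at h2
  rw [Real.rpow_add hn, Real.rpow_one, abs_le]
  constructor <;> nlinarith

end Order

/-! ### Geometries from two trees joined at their leaves -/

lemma edist_hom_le {V W : Type*} {G : SimpleGraph V} {H : SimpleGraph W} (f : G →g H) (u v : V) :
    H.edist (f u) (f v) ≤ G.edist u v := by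
  rw [G.edist_eq_sInf]
  refine le_sInf ?_
  rintro _ ⟨p, rfl⟩
  simpa using SimpleGraph.edist_le (p.map f)

lemma edist_iso {V W : Type*} {G : SimpleGraph V} {H : SimpleGraph W} (e : G ≃g H) (u v : V) :
    H.edist (e u) (e v) = G.edist u v := by
  refine le_antisymm (edist_hom_le e.toHom u v) ?_
  have h := edist_hom_le e.symm.toHom (e u) (e v)
  have hu : e.symm.toHom (e u) = u := e.symm_apply_apply u
  have hv : e.symm.toHom (e v) = v := e.symm_apply_apply v
  rwa [hu, hv] at h

lemma ediam_le_of_iso {V W : Type*} {G : SimpleGraph V} {H : SimpleGraph W} (e : G ≃g H) :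
    G.ediam ≤ H.ediam :=
  SimpleGraph.ediam_le_of_edist_le fun u v => edist_iso e u v ▸ SimpleGraph.edist_le_ediam

namespace TreeGeometry

variable {F : Type} {R : List F → List F → Prop} {k : ℕ}

/-- The length of a sequence in either of the two trees. -/
def size (u : List F ⊕ List F) : ℕ := Sum.elim List.length List.length u

@[simp] lemma size_inl (x : List F) : size (Sum.inl x) = x.length := rfl

@[simp] lemma size_inr (x : List F) : size (Sum.inr x) = x.length := rfl

/-- The edges, in one orientation: in each of two trees of finite sequences, a sequence is joined to
its extensions by one term; the two roots are joined; the leaves of the two trees are joined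
according to `R`. -/
inductive Link (R : List F → List F → Prop) : List F ⊕ List F → List F ⊕ List F → Prop
  | root : Link R (Sum.inl []) (Sum.inr [])
  | left (x : List F) (c : F) : Link R (Sum.inl x) (Sum.inl (x ++ [c]))
  | right (x : List F) (c : F) : Link R (Sum.inr x) (Sum.inr (x ++ [c]))
  | leaf (x y : List F) (h : R x y) : Link R (Sum.inl x) (Sum.inr y)

/-- Adjacency of the two sequences in the union of the two trees and the leaf relation. -/
def Linked (R : List F → List F → Prop) (u v : List F ⊕ List F) : Prop := Link R u v ∨ Link R v u

lemma Link.ne {u v : List F ⊕ List F} (h : Link R u v) : u ≠ v := by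
  cases h <;> simp

/-- The two trees of sequences of length at most `k`, joined at the roots and at the leaves. -/
def graph (R : List F → List F → Prop) (k : ℕ) : SimpleGraph {u : List F ⊕ List F // size u ≤ k} where
  Adj u v := Linked R u v
  symm := ⟨fun _ _ h => h.symm⟩
  loopless := ⟨fun _ h => h.elim (fun h => h.ne rfl) fun h => h.ne rfl⟩

/-- The points, which also label the lines, are the sequences of length at most `k`. The incidence
is symmetric, so that identifying each point with the line of the same label is a polarity. -/
def Incident (R : List F → List F → Prop) (k : ℕ) (x y : {x : List F // x.length ≤ k}) : Prop :=
  (x.1 = [] ∧ y.1 = []) ∨ (∃ c, y.1 = x.1 ++ [c]) ∨ (∃ c, x.1 = y.1 ++ [c]) ∨ R x.1 y.1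

/-- The relation `R` between the leaves, the sequences of length `k`, is symmetric, and every leaf
is related to exactly one leaf with a given first term. -/
structure IsLeafRelation (R : List F → List F → Prop) (k : ℕ) : Prop where
  pos : 1 ≤ k
  length_left : ∀ {x y}, R x y → x.length = k
  symm : ∀ {x y}, R x y → R y x
  existsUnique : ∀ x : List F, x.length = k → ∀ c, ∃! y, R x y ∧ y.head? = some c

namespace IsLeafRelation

lemma length_right (hR : IsLeafRelation R k) {x y : List F} (h : R x y) : y.length = k := hR.length_left (hR.symm h)

lemma incident_symm (hR : IsLeafRelation R k) {x y : {x : List F // x.length ≤ k}} (h : Incident R k x y) :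
    Incident R k y x := by
  rcases h with ⟨h1, h2⟩ | h | h | h
  · exact Or.inl ⟨h2, h1⟩
  · exact Or.inr (Or.inr (Or.inl h))
  · exact Or.inr (Or.inl h)
  · exact Or.inr (Or.inr (Or.inr (hR.symm h)))

lemma incident_iff (hR : IsLeafRelation R k) (x y : {x : List F // x.length ≤ k}) :
    Incident R k x y ↔ Incident R k y x := ⟨hR.incident_symm, hR.incident_symm⟩

/-- The identity is a polarity. -/
def polarity (hR : IsLeafRelation R k) : Polarity (Incident R k) :=
  ⟨Equiv.refl _, fun p l => hR.incident_iff p l⟩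

lemma not_nil_left (hR : IsLeafRelation R k) {y : List F} : ¬ R [] y := by
  intro h
  have h1 := hR.length_left h
  have h2 := hR.pos
  simp at h1
  omega

/-- The vertices of the trees as points and lines: levels alternate between points and lines, and
the left root is a point, the right root a line. -/
def toIncidence (k : ℕ) : {u : List F ⊕ List F // size u ≤ k} ≃
    {x : List F // x.length ≤ k} ⊕ {x : List F // x.length ≤ k} where
  toFun
    | ⟨Sum.inl x, h⟩ => if Even x.length then Sum.inl ⟨x, h⟩ else Sum.inr ⟨x, h⟩
    | ⟨Sum.inr x, h⟩ => if Even x.length then Sum.inr ⟨x, h⟩ else Sum.inl ⟨x, h⟩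
  invFun
    | Sum.inl x => if Even x.1.length then ⟨Sum.inl x.1, x.2⟩ else ⟨Sum.inr x.1, x.2⟩
    | Sum.inr x => if Even x.1.length then ⟨Sum.inr x.1, x.2⟩ else ⟨Sum.inl x.1, x.2⟩
  left_inv := by
    rintro ⟨x | x, h⟩ <;> by_cases he : Even x.length <;> simp [he]
  right_inv := by
    rintro (⟨x, h⟩ | ⟨x, h⟩) <;> by_cases he : Even x.length <;> simp [he]

lemma adj_toIncidence_of_link (hR : IsLeafRelation R k) {u v : {u : List F ⊕ List F // size u ≤ k}}
    (h : Link R u v) :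
    (incidenceGraph (Incident R k)).Adj (toIncidence k u) (toIncidence k v) := by
  obtain ⟨u, hu⟩ := u
  obtain ⟨v, hv⟩ := v
  dsimp only at h
  cases h with
  | root => simp [toIncidence, Incident]
  | left x c =>
    by_cases he : Even x.length <;>
      simp [toIncidence, he, Nat.even_add_one, Incident]
  | right x c =>
    by_cases he : Even x.length <;>
      simp [toIncidence, he, Nat.even_add_one, Incident]
  | leaf x y h =>
    have h1 := hR.length_left h
    have h2 := hR.length_right h
    by_cases he : Even k <;> simp [toIncidence, he, h1, h2, Incident, h, hR.symm h]

lemma linked_of_incident (hR : IsLeafRelation R k) {x y : {x : List F // x.length ≤ k}}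
    (h : Incident R k x y) :
    (graph R k).Adj ((toIncidence k).symm (Sum.inl x)) ((toIncidence k).symm (Sum.inr y)) := by
  obtain ⟨x, hx⟩ := x
  obtain ⟨y, hy⟩ := y
  rcases h with ⟨rfl, rfl⟩ | ⟨c, rfl⟩ | ⟨c, rfl⟩ | h
  · exact Or.inl (by simpa [toIncidence] using Link.root)
  · by_cases he : Even x.length
    · exact Or.inl (by simpa [toIncidence, he, Nat.even_add_one] using Link.left x c)
    · exact Or.inl (by simpa [toIncidence, he, Nat.even_add_one] using Link.right x c)
  · by_cases he : Even y.length
    · exact Or.inr (by simpa [toIncidence, he, Nat.even_add_one] using Link.right y c)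
    · exact Or.inr (by simpa [toIncidence, he, Nat.even_add_one] using Link.left y c)
  · have h1 := hR.length_left h
    have h2 := hR.length_right h
    dsimp only at h1 h2 h
    by_cases he : Even k
    · exact Or.inl (by simpa [toIncidence, he, h1, h2] using Link.leaf _ _ h)
    · exact Or.inr (by simpa [toIncidence, he, h1, h2] using Link.leaf _ _ (hR.symm h))

/-- The incidence graph of the geometry. -/
def isoIncidenceGraph (hR : IsLeafRelation R k) : graph R k ≃g incidenceGraph (Incident R k) where
  toEquiv := toIncidence k
  map_rel_iff' := by
    intro u v
    constructor
    · intro h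
      have key : ∀ a b, (incidenceGraph (Incident R k)).Adj a b →
          (graph R k).Adj ((toIncidence k).symm a) ((toIncidence k).symm b) := by
        rintro (a | a) (b | b) hab
        · exact hab.elim
        · exact hR.linked_of_incident hab
        · exact (hR.linked_of_incident hab).symm
        · exact hab.elim
      simpa using key _ _ h
    · rintro (h | h)
      · exact hR.adj_toIncidence_of_link h
      · exact (hR.adj_toIncidence_of_link h).symm

lemma incident_eq_insert_range [Nonempty F] (hR : IsLeafRelation R k)
    (x : {x : List F // x.length ≤ k}) :
    ∃ (x' : {x : List F // x.length ≤ k}) (f : F → {x : List F // x.length ≤ k}),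
      Function.Injective f ∧ x' ∉ Set.range f ∧ {y | Incident R k x y} = insert x' (Set.range f) := by
  have hk := hR.pos
  have hparent : ∀ y : List F, ((x.1 = [] ∧ y = []) ∨ ∃ c, x.1 = y ++ [c]) ↔ y = x.1.dropLast := by
    intro y
    constructor
    · rintro (⟨h1, rfl⟩ | ⟨c, h⟩)
      · simp [h1]
      · simp [h]
    · rintro rfl
      rcases List.eq_nil_or_concat x.1 with h | ⟨z, c, h⟩
      · simp [h]
      · right
        exact ⟨c, by simp [h]⟩
  have hx' : x.1.dropLast.length ≤ k := by
    have := x.2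
    simp
    omega
  rcases x.2.lt_or_eq with hlt | heq
  · refine ⟨⟨x.1.dropLast, hx'⟩, fun c => ⟨x.1 ++ [c], by simpa using hlt⟩, ?_, ?_, ?_⟩
    · intro c c' h
      simpa using h
    · rintro ⟨c, hc⟩
      have := congrArg (fun y : {x : List F // x.length ≤ k} => y.1.length) hc
      simp at this
      omega
    · ext y
      have hno : ¬ R x.1 y.1 := fun h => by have := hR.length_left h; omega
      simp only [Set.mem_ofPred_eq, Incident, hno, or_false, Set.mem_insert_iff, Set.mem_range,
        Subtype.ext_iff, ← hparent]
      constructor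
      · rintro (h | ⟨c, h⟩ | h)
        · exact Or.inl (Or.inl h)
        · exact Or.inr ⟨c, h.symm⟩
        · exact Or.inl (Or.inr h)
      · rintro ((h | h) | ⟨c, h⟩)
        · exact Or.inl h
        · exact Or.inr (Or.inr h)
        · exact Or.inr (Or.inl ⟨c, h.symm⟩)
  · choose f hf hf' using fun c => hR.existsUnique x.1 heq c
    refine ⟨⟨x.1.dropLast, hx'⟩, fun c => ⟨f c, (hR.length_right (hf c).1).le⟩, ?_, ?_, ?_⟩
    · intro c c' h
      have h' : f c = f c' := by simpa using h
      have h1 := (hf c).2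
      rw [h', (hf c').2] at h1
      exact (Option.some_injective _ h1).symm
    · rintro ⟨c, hc⟩
      have := congrArg (fun y : {x : List F // x.length ≤ k} => y.1.length) hc
      simp [hR.length_right (hf c).1, heq] at this
      omega
    · ext y
      have hno : ¬ ∃ c, y.1 = x.1 ++ [c] := by
        rintro ⟨c, hc⟩
        have h1 := y.2
        rw [hc] at h1
        simp [heq] at h1
      simp only [Set.mem_ofPred_eq, Incident, hno, false_or, Set.mem_insert_iff, Set.mem_range,
        Subtype.ext_iff, ← hparent]
      constructor
      · rintro (h | h | h)
        · exact Or.inl (Or.inl h)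
        · exact Or.inl (Or.inr h)
        · obtain ⟨c, hc⟩ : ∃ c, y.1.head? = some c := by
            have := hR.length_right h
            cases hy : y.1 with
            | nil => rw [hy] at this; simp at this; omega
            | cons c l => exact ⟨c, rfl⟩
          exact Or.inr ⟨c, (hf' c _ ⟨h, hc⟩).symm⟩
      · rintro ((h | h) | ⟨c, h⟩)
        · exact Or.inl h
        · exact Or.inr (Or.inl h)
        · exact Or.inr (Or.inr (h ▸ (hf c).1))

lemma hasOrder [Finite F] [Nonempty F] (hR : IsLeafRelation R k) :
    HasOrder (Incident R k) (Nat.card F) := by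
  have key : ∀ x, {y | Incident R k x y}.ncard = Nat.card F + 1 := by
    intro x
    obtain ⟨x', f, hf, hx', h⟩ := hR.incident_eq_insert_range x
    rw [h, Set.ncard_insert_of_notMem hx' (Set.finite_range f), ← Set.image_univ,
      Set.ncard_image_of_injective _ hf, Set.ncard_univ]
  refine ⟨fun l => ?_, key⟩
  rw [← key l]
  exact congrArg Set.ncard (Set.ext fun p => hR.incident_iff p l)

end IsLeafRelation

section Girth

/-- The root of the left tree. -/
def leftRoot (k : ℕ) : {u : List F ⊕ List F // size u ≤ k} := ⟨Sum.inl [], Nat.zero_le k⟩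

/-- The root of the right tree. -/
def rightRoot (k : ℕ) : {u : List F ⊕ List F // size u ≤ k} := ⟨Sum.inr [], Nat.zero_le k⟩

lemma adj_roots : (graph R k).Adj (leftRoot k) (rightRoot k) := Or.inl Link.root

lemma eq_of_adj_rightRoot (hR : IsLeafRelation R k) {w : {u : List F ⊕ List F // size u ≤ k}}
    (h : (graph R k).Adj w (rightRoot k)) : w = leftRoot k ∨ ∃ a, w.1 = Sum.inr [a] := by
  obtain ⟨w, hw⟩ := w
  simp only [leftRoot]
  have h' : Link R w (Sum.inr []) ∨ Link R (Sum.inr []) w := h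
  rcases h' with h | h
  · generalize hz : (Sum.inr [] : List F ⊕ List F) = z at h
    cases h with
    | root => exact Or.inl rfl
    | left x c => simp at hz
    | right x c => simp at hz
    | leaf x y h =>
      obtain rfl : [] = y := by simpa using hz
      exact (hR.not_nil_left (hR.symm h)).elim
  · generalize hz : (Sum.inr [] : List F ⊕ List F) = z at h
    cases h with
    | root => simp at hz
    | left x c => simp at hz
    | right x c =>
      obtain rfl : [] = x := by simpa using hz
      exact Or.inr ⟨c, rfl⟩
    | leaf x y h => simp at hz

/-- The exchange of the two trees. -/
def swap (hR : IsLeafRelation R k) : graph R k ≃g graph R k where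
  toFun u := ⟨u.1.swap, by obtain ⟨u | u, h⟩ := u <;> exact h⟩
  invFun u := ⟨u.1.swap, by obtain ⟨u | u, h⟩ := u <;> exact h⟩
  left_inv u := by simp
  right_inv u := by simp
  map_rel_iff' := by
    have key : ∀ u v : List F ⊕ List F, Link R u v → Linked R u.swap v.swap := by
      intro u v h
      cases h with
      | root => exact Or.inr Link.root
      | left x c => exact Or.inl (Link.right x c)
      | right x c => exact Or.inl (Link.left x c)
      | leaf x y h => exact Or.inr (Link.leaf y x (hR.symm h))
    have key' : ∀ u v : List F ⊕ List F, Linked R u v → Linked R u.swap v.swap :=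
      fun u v h => h.elim (key u v) fun h => (key v u h).symm
    intro u v
    constructor
    · intro h
      have h' : Linked R u.1.swap.swap v.1.swap.swap := key' _ _ h
      rwa [Sum.swap_swap, Sum.swap_swap] at h'
    · exact key' _ _

@[simp] lemma swap_leftRoot (hR : IsLeafRelation R k) : swap hR (leftRoot k) = rightRoot k := rfl

@[simp] lemma swap_rightRoot (hR : IsLeafRelation R k) : swap hR (rightRoot k) = leftRoot k := rfl

lemma exists_walk_left (x : List F) : ∀ {v : {u : List F ⊕ List F // size u ≤ k}},
    v.1 = Sum.inl x → ∃ p : (graph R k).Walk v (leftRoot k), p.length = x.length ∧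
      ∀ z ∈ p.support, z.1.isLeft = true := by
  induction x using List.reverseRecOn with
  | nil =>
    intro v hv
    obtain rfl : v = leftRoot k := Subtype.ext hv
    exact ⟨SimpleGraph.Walk.nil, rfl, by simp [hv]⟩
  | append_singleton x c ih =>
    intro v hv
    have hx : size (Sum.inl x : List F ⊕ List F) ≤ k := by
      have h := v.2
      rw [hv] at h
      simp only [size_inl, List.length_append, List.length_singleton] at h ⊢
      omega
    obtain ⟨p, hp, hp'⟩ := ih (v := ⟨Sum.inl x, hx⟩) rfl
    have hadj : (graph R k).Adj v ⟨Sum.inl x, hx⟩ := Or.inr (hv ▸ Link.left x c)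
    exact ⟨SimpleGraph.Walk.cons hadj p, by simp [hp], by simpa [hv] using hp'⟩

lemma exists_walk_right (x : List F) : ∀ {v : {u : List F ⊕ List F // size u ≤ k}},
    v.1 = Sum.inr x → ∃ p : (graph R k).Walk v (rightRoot k), p.length = x.length ∧
      ∀ z ∈ p.support, z.1.isLeft = false := by
  induction x using List.reverseRecOn with
  | nil =>
    intro v hv
    obtain rfl : v = rightRoot k := Subtype.ext hv
    exact ⟨SimpleGraph.Walk.nil, rfl, by simp [hv]⟩
  | append_singleton x c ih =>
    intro v hv
    have hx : size (Sum.inr x : List F ⊕ List F) ≤ k := by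
      have h := v.2
      rw [hv] at h
      simp only [size_inr, List.length_append, List.length_singleton] at h ⊢
      omega
    obtain ⟨p, hp, hp'⟩ := ih (v := ⟨Sum.inr x, hx⟩) rfl
    have hadj : (graph R k).Adj v ⟨Sum.inr x, hx⟩ := Or.inr (hv ▸ Link.right x c)
    exact ⟨SimpleGraph.Walk.cons hadj p, by simp [hp], by simpa [hv] using hp'⟩

/-- The walk from a leaf of the right tree over a leaf of the left tree to the left root. -/
lemma exists_walk_leaf [Nonempty F] (hR : IsLeafRelation R k) {x : List F} (hx : x.length = k)
    {v : {u : List F ⊕ List F // size u ≤ k}} (hv : v.1 = Sum.inr x) :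
    ∃ p : (graph R k).Walk v (leftRoot k), p.length = k + 1 ∧
      s(leftRoot k, rightRoot k) ∉ p.edges := by
  obtain ⟨c⟩ := ‹Nonempty F›
  obtain ⟨y, ⟨hy, -⟩, -⟩ := hR.existsUnique x hx c
  have hyk : size (Sum.inl y : List F ⊕ List F) = k := hR.length_right hy
  obtain ⟨p, hp, hp'⟩ := exists_walk_left (R := R) y (v := ⟨Sum.inl y, hyk.le⟩) rfl
  have hadj : (graph R k).Adj v ⟨Sum.inl y, hyk.le⟩ := Or.inr (hv ▸ Link.leaf y x (hR.symm hy))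
  refine ⟨SimpleGraph.Walk.cons hadj p, ?_, ?_⟩
  · rw [SimpleGraph.Walk.length_cons, hp, ← size_inl, hyk]
  rw [SimpleGraph.Walk.edges_cons, List.mem_cons]
  rintro (h | h)
  · have hk := hR.pos
    rw [Sym2.eq_iff] at h
    rcases h with ⟨h, -⟩ | ⟨-, h⟩
    · have := congrArg Subtype.val h
      rw [hv] at this
      cases this
    · have := congrArg Subtype.val h
      rw [hv] at this
      obtain rfl : [] = x := Sum.inr_injective this
      simp at hx
      omega
  · have := hp' _ (p.snd_mem_support_of_mem_edges h)
    simp [rightRoot] at this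

lemma exists_walk_leftRoot (v : {u : List F ⊕ List F // size u ≤ k}) :
    ∃ p : (graph R k).Walk v (leftRoot k), p.length ≤ k + 1 := by
  have h := v.2
  rcases hv : v.1 with x | x <;> rw [hv] at h
  · obtain ⟨p, hp, -⟩ := exists_walk_left (R := R) x hv
    exact ⟨p, by rw [hp]; exact Nat.le_succ_of_le h⟩
  · obtain ⟨p, hp, -⟩ := exists_walk_right (R := R) x hv
    refine ⟨p.concat adj_roots.symm, ?_⟩
    rw [SimpleGraph.Walk.length_concat, hp]
    exact Nat.succ_le_succ h

/-- If the automorphisms fixing the right root are transitive on its neighbours, then the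
automorphism group is transitive on oriented edges, by connectedness and the exchange of the two
trees. -/
lemma exists_aut_of_adj [Nonempty F] (hR : IsLeafRelation R k)
    (haut : ∀ (a : F) (w : {u : List F ⊕ List F // size u ≤ k}), w.1 = Sum.inr [a] →
      ∃ g : graph R k ≃g graph R k, g (rightRoot k) = rightRoot k ∧ g w = leftRoot k)
    {u v : {u : List F ⊕ List F // size u ≤ k}} (huv : (graph R k).Adj u v) :
    ∃ g : graph R k ≃g graph R k, g u = leftRoot k ∧ g v = rightRoot k := by
  have base : ∀ w, (graph R k).Adj w (rightRoot k) →
      ∃ g : graph R k ≃g graph R k, g w = leftRoot k ∧ g (rightRoot k) = rightRoot k := by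
    intro w hw
    rcases eq_of_adj_rightRoot hR hw with rfl | ⟨a, ha⟩
    · exact ⟨RelIso.refl _, rfl, rfl⟩
    · obtain ⟨g, h1, h2⟩ := haut a w ha
      exact ⟨g, h2, h1⟩
  have key : ∀ {z y} (_ : (graph R k).Walk z y), y = rightRoot k → ∀ w, (graph R k).Adj w z →
      ∃ g : graph R k ≃g graph R k, g w = leftRoot k ∧ g z = rightRoot k := by
    intro z y p
    induction p with
    | nil =>
      rintro rfl w hw
      exact base w hw
    | cons h p ih =>
      intro hy w hw
      obtain ⟨g, h1, h2⟩ := ih hy _ h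
      have h3 := (swap hR).map_adj_iff.2 (g.map_adj_iff.2 hw)
      rw [h1, swap_leftRoot] at h3
      obtain ⟨g', h4, h5⟩ := base _ h3
      refine ⟨(g.trans (swap hR)).trans g', h4, ?_⟩
      simpa [h1] using h5
  obtain ⟨p, -⟩ := exists_walk_leftRoot (R := R) v
  exact key (p.concat adj_roots) rfl u huv

/-- The position on the closed chain from the left root through the leaves to the right root. -/
def height (k : ℕ) (u : List F ⊕ List F) : ℤ := Sum.elim (fun x => (x.length : ℤ))
  (fun x => 2 * k + 1 - x.length) u

/-- A walk that avoids the edge between the roots changes the height by at most its length. -/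
lemma height_le_add_length (hR : IsLeafRelation R k) {u v : {u : List F ⊕ List F // size u ≤ k}}
    (p : (graph R k).Walk u v) (hp : s(leftRoot k, rightRoot k) ∉ p.edges) :
    height k u.1 ≤ height k v.1 + p.length := by
  have key : ∀ u v : List F ⊕ List F, Link R u v →
      (u = Sum.inl [] ∧ v = Sum.inr []) ∨ |height k u - height k v| ≤ 1 := by
    intro u v h
    cases h with
    | root => exact Or.inl ⟨rfl, rfl⟩
    | left x c => right; simp [height]
    | right x c => right; simp [height]
    | leaf x y h => right; simp [height, hR.length_left h, hR.length_right h]; ring_nf; simp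
  induction p with
  | nil => simp
  | @cons u z v h p ih =>
    rw [SimpleGraph.Walk.edges_cons, List.mem_cons, not_or] at hp
    have h1 := ih hp.2
    have h2 : |height k u.1 - height k z.1| ≤ 1 := by
      have h' : Link R u z ∨ Link R z u := h
      rcases h' with h' | h'
      · rcases key _ _ h' with ⟨h3, h4⟩ | h3
        · exact (hp.1 (Sym2.eq_iff.2 (Or.inl ⟨Subtype.ext h3.symm, Subtype.ext h4.symm⟩))).elim
        · exact h3
      · rcases key _ _ h' with ⟨h3, h4⟩ | h3
        · exact (hp.1 (Sym2.eq_iff.2 (Or.inr ⟨Subtype.ext h3.symm, Subtype.ext h4.symm⟩))).elim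
        · rwa [abs_sub_comm]
    have h3 := (abs_le.1 h2).2
    push_cast [SimpleGraph.Walk.length_cons]
    linarith

/-- The distance from the left root is at least the length, plus one in the right tree. -/
lemma depth_le_length (hR : IsLeafRelation R k) {u v : {u : List F ⊕ List F // size u ≤ k}}
    (p : (graph R k).Walk u v) :
    (Sum.elim List.length (fun x => x.length + 1) u.1 : ℕ) ≤
      Sum.elim List.length (fun x => x.length + 1) v.1 + p.length := by
  have key : ∀ u v : List F ⊕ List F, Link R u v →
      (Sum.elim List.length (fun x => x.length + 1) u : ℕ) ≤
        Sum.elim List.length (fun x => x.length + 1) v + 1 ∧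
      (Sum.elim List.length (fun x => x.length + 1) v : ℕ) ≤
        Sum.elim List.length (fun x => x.length + 1) u + 1 := by
    intro u v h
    cases h with
    | root => simp
    | left x c => simp; omega
    | right x c => simp
    | leaf x y h => simp [hR.length_left h, hR.length_right h]; omega
  induction p with
  | nil => simp
  | @cons u z v h p ih =>
    have h' : Link R u z ∨ Link R z u := h
    have h1 := h'.elim (fun h => (key _ _ h).1) (fun h => (key _ _ h).2)
    rw [SimpleGraph.Walk.length_cons]
    omega

theorem ediam_graph [Nonempty F] (hR : IsLeafRelation R k)
    (haut : ∀ (a : F) (w : {u : List F ⊕ List F // size u ≤ k}), w.1 = Sum.inr [a] →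
      ∃ g : graph R k ≃g graph R k, g (rightRoot k) = rightRoot k ∧ g w = leftRoot k) :
    (graph R k).ediam = ((k + 1 : ℕ) : ℕ∞) := by
  refine le_antisymm (SimpleGraph.ediam_le_of_edist_le fun u v => ?_) ?_
  · obtain ⟨w, hw⟩ : ∃ w, (graph R k).Adj u w := by
      obtain ⟨p, -⟩ := exists_walk_leftRoot (R := R) u
      cases p with
      | nil => exact ⟨_, adj_roots⟩
      | cons h _ => exact ⟨_, h⟩
    obtain ⟨g, hg, -⟩ := exists_aut_of_adj hR haut hw
    obtain ⟨p, hp⟩ := exists_walk_leftRoot (R := R) (g v)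
    rw [← edist_iso g, hg, SimpleGraph.edist_comm]
    exact (SimpleGraph.edist_le p).trans (by exact_mod_cast hp)
  · obtain ⟨c⟩ := ‹Nonempty F›
    refine le_trans ?_ (SimpleGraph.edist_le_ediam (u := ⟨Sum.inr (List.replicate k c), by simp⟩)
      (v := leftRoot k))
    rw [SimpleGraph.edist_eq_sInf]
    refine le_sInf ?_
    rintro _ ⟨p, rfl⟩
    have := depth_le_length hR p
    simp only [leftRoot, Sum.elim_inl, Sum.elim_inr, List.length_replicate, List.length_nil,
      zero_add] at this
    exact Nat.cast_le.2 this

/-- A cycle can be moved so as to contain the edge between the roots, and then it has to pass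
through both trees. -/
theorem egirth_graph [Nonempty F] (hR : IsLeafRelation R k)
    (haut : ∀ (a : F) (w : {u : List F ⊕ List F // size u ≤ k}), w.1 = Sum.inr [a] →
      ∃ g : graph R k ≃g graph R k, g (rightRoot k) = rightRoot k ∧ g w = leftRoot k) :
    (graph R k).egirth = ((2 * (k + 1) : ℕ) : ℕ∞) := by
  classical
  refine le_antisymm ?_ (SimpleGraph.le_egirth.2 fun a w hw => ?_)
  · have hne := ‹Nonempty F›
    obtain ⟨c⟩ := hne
    have hx : size (Sum.inr (List.replicate k c) : List F ⊕ List F) ≤ k := by simp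
    obtain ⟨p, hp, hp'⟩ := exists_walk_leaf hR (v := ⟨_, hx⟩) List.length_replicate rfl
    obtain ⟨r, hr, hr'⟩ := exists_walk_right (R := R) (List.replicate k c) (v := ⟨_, hx⟩) rfl
    rw [List.length_replicate] at hr
    have hedge : s(leftRoot k, rightRoot k) ∉ (r.reverse.append p).bypass.edges := by
      intro h
      have h1 := SimpleGraph.Walk.edges_bypass_subset_edges _ h
      rw [SimpleGraph.Walk.edges_append, List.mem_append, SimpleGraph.Walk.edges_reverse,
        List.mem_reverse] at h1
      rcases h1 with h1 | h1
      · have := hr' _ (r.fst_mem_support_of_mem_edges h1)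
        simp [leftRoot] at this
      · exact hp' h1
    have hcyc := (SimpleGraph.Walk.cons_isCycle_iff _ (adj_roots (R := R) (k := k))).2
      ⟨(r.reverse.append p).bypass_isPath, hedge⟩
    refine (SimpleGraph.egirth_le_length hcyc).trans ?_
    have hlen := (r.reverse.append p).length_bypass_le_length
    rw [SimpleGraph.Walk.length_append, SimpleGraph.Walk.length_reverse, hp, hr] at hlen
    rw [SimpleGraph.Walk.length_cons]
    exact Nat.cast_le.2 (by omega)
  · cases w with
    | nil => simp at hw
    | cons h p =>
      rw [SimpleGraph.Walk.cons_isCycle_iff] at hw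
      obtain ⟨g, h1, h2⟩ := exists_aut_of_adj hR haut h
      have key := height_le_add_length hR (p.map g.toHom) (by
        rw [SimpleGraph.Walk.edges_map, List.mem_map]
        rintro ⟨e, he, heq⟩
        have h3 : Sym2.map g.toHom e = Sym2.map g.toHom s(_, _) := heq.trans (by
          rw [Sym2.map_mk]
          exact congrArg₂ (fun x y => s(x, y)) h1.symm h2.symm)
        exact hw.2 (Sym2.map.injective g.injective h3 ▸ he))
      have e1 : height k (g.toHom _).1 = height k (leftRoot k).1 := congrArg (height k ·.1) h1
      have e2 : height k (g.toHom _).1 = height k (rightRoot k).1 := congrArg (height k ·.1) h2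
      rw [e1, e2, SimpleGraph.Walk.length_map] at key
      simp only [height, leftRoot, rightRoot, Sum.elim_inl, Sum.elim_inr, List.length_nil] at key
      rw [SimpleGraph.Walk.length_cons]
      push_cast at key
      exact Nat.cast_le.2 (by omega)

theorem isGeneralizedPolygon [Nonempty F] (hR : IsLeafRelation R k)
    (haut : ∀ (a : F) (w : {u : List F ⊕ List F // size u ≤ k}), w.1 = Sum.inr [a] →
      ∃ g : graph R k ≃g graph R k, g (rightRoot k) = rightRoot k ∧ g w = leftRoot k) :
    IsGeneralizedPolygon (Incident R k) (k + 1) := by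
  have e := hR.isoIncidenceGraph
  refine ⟨?_, by rw [← e.egirth_eq, egirth_graph hR haut]⟩
  rw [← ediam_graph hR haut]
  exact le_antisymm (ediam_le_of_iso e.symm) (ediam_le_of_iso e)

end Girth

end TreeGeometry

/-! ### Planes, quadrangles and hexagons in coordinates -/

namespace TreeGeometry

section Automorphisms

variable {F : Type} {R : List F → List F → Prop} {k : ℕ}

/-- A map of the sequences of length at most `k` that preserves the length bound and adjacency. -/
structure IsGraphMap (R : List F → List F → Prop) (k : ℕ)
    (f : List F ⊕ List F → List F ⊕ List F) : Prop where
  size_le : ∀ u, size u ≤ k → size (f u) ≤ k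
  linked : ∀ u v, size u ≤ k → size v ≤ k → Link R u v → Linked R (f u) (f v)

/-- The automorphism given by two mutually inverse maps of sequences. -/
def autOfMaps {f g : List F ⊕ List F → List F ⊕ List F} (hf : IsGraphMap R k f)
    (hg : IsGraphMap R k g) (hgf : ∀ u, size u ≤ k → g (f u) = u)
    (hfg : ∀ u, size u ≤ k → f (g u) = u) : graph R k ≃g graph R k where
  toFun u := ⟨f u.1, hf.size_le u.1 u.2⟩
  invFun u := ⟨g u.1, hg.size_le u.1 u.2⟩
  left_inv u := Subtype.ext (hgf u.1 u.2)
  right_inv u := Subtype.ext (hfg u.1 u.2)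
  map_rel_iff' := by
    have key : ∀ {f : List F ⊕ List F → List F ⊕ List F}, IsGraphMap R k f → ∀ u v, size u ≤ k →
        size v ≤ k → Linked R u v → Linked R (f u) (f v) := fun hf u v hu hv h =>
      h.elim (hf.linked u v hu hv) fun h => (hf.linked v u hv hu h).symm
    intro u v
    constructor
    · intro h
      have h' : Linked R (g (f u.1)) (g (f v.1)) :=
        key hg _ _ (hf.size_le u.1 u.2) (hf.size_le v.1 v.2) h
      rwa [hgf u.1 u.2, hgf v.1 v.2] at h'
    · exact key hf _ _ u.2 v.2

/-- Invertible maps `T c` that fix the right root and translate its neighbours, together with an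
involution `S` that fixes the right root and exchanges two of its neighbours, provide the symmetry
from which the polygon property follows. -/
theorem exists_polygon_of_maps [AddGroup F] [Finite F] (hR : IsLeafRelation R k)
    {T : F → List F ⊕ List F → List F ⊕ List F} {S : List F ⊕ List F → List F ⊕ List F}
    (hT : ∀ c, IsGraphMap R k (T c)) (hTT : ∀ c u, size u ≤ k → T (-c) (T c u) = u)
    (hT0 : ∀ c, T c (Sum.inr []) = Sum.inr []) (hT1 : ∀ c a, T c (Sum.inr [a]) = Sum.inr [a + c])
    (hS : IsGraphMap R k S) (hSS : ∀ u, size u ≤ k → S (S u) = u)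
    (hS0 : S (Sum.inr []) = Sum.inr []) (hS1 : S (Sum.inr [0]) = Sum.inl []) :
    ∃ (P L : Type) (_ : Finite P) (_ : Finite L) (I : P → L → Prop),
      IsGeneralizedPolygon I (k + 1) ∧ HasOrder I (Nat.card F) ∧ Nonempty (Polarity I) := by
  have hfin : Finite {x : List F // x.length ≤ k} := List.finite_length_le F k
  refine ⟨_, _, hfin, hfin, Incident R k, isGeneralizedPolygon hR ?_, hR.hasOrder, ⟨hR.polarity⟩⟩
  intro a w hw
  refine ⟨(autOfMaps (hT (-a)) (hT a) (fun u hu => ?_) (hTT a)).trans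
    (autOfMaps hS hS hSS hSS), Subtype.ext ?_, Subtype.ext ?_⟩
  · have := hTT (-a) u hu
    rwa [neg_neg] at this
  · change S (T (-a) (Sum.inr [])) = Sum.inr []
    rw [hT0, hS0]
  · change S (T (-a) w.1) = Sum.inl []
    rw [hw, hT1, add_neg_cancel, hS1]

end Automorphisms

section Quadrangle

variable {F : Type} [Field F]

/-- The leaf relation of the symplectic quadrangle in characteristic two, for an endomorphism `θ`
whose square is the Frobenius endomorphism. -/
inductive QuadrangleRel (θ : F →+* F) : List F → List F → Prop
  | mk (y₁ y₂ y₃ x₁ x₂ x₃ : F) (h₁ : y₃ = x₂ + θ x₁ * y₁) (h₂ : x₃ = y₂ + θ y₁ * x₁) :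
    QuadrangleRel θ [y₁, y₂, y₃] [x₁, x₂, x₃]

lemma isLeafRelation_quadrangleRel (θ : F →+* F) :
    IsLeafRelation (QuadrangleRel θ) 3 where
  pos := by norm_num
  length_left := by rintro _ _ ⟨⟩; rfl
  symm := by
    rintro _ _ ⟨y₁, y₂, y₃, x₁, x₂, x₃, h₁, h₂⟩
    exact .mk _ _ _ _ _ _ h₂ h₁
  existsUnique := by
    intro x hx c
    obtain ⟨y₁, y₂, y₃, rfl⟩ := List.length_eq_three.1 hx
    refine ⟨[c, y₃ - θ c * y₁, y₂ + θ y₁ * c], ⟨.mk _ _ _ _ _ _ (by ring) rfl, rfl⟩, ?_⟩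
    rintro _ ⟨⟨_, _, _, x₁, x₂, x₃, h₁, h₂⟩, hc⟩
    obtain rfl : x₁ = c := by simpa using hc
    rw [h₁, h₂]
    simp

/-- The automorphism that translates the first coordinates of the right tree by `c`. -/
def quadrangleShear (θ : F →+* F) (c : F) : List F ⊕ List F → List F ⊕ List F
  | Sum.inl [y₁, y₂] => Sum.inl [y₁, y₂ - c * θ y₁]
  | Sum.inl [y₁, y₂, y₃] => Sum.inl [y₁, y₂ - c * θ y₁, y₃ + θ c * y₁]
  | Sum.inr (x₁ :: l) => Sum.inr ((x₁ + c) :: l)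
  | u => u

open scoped Classical in
/-- The automorphism that fixes the right root, and with it the set of its neighbours, on which it
exchanges the left root with the first coordinate `0` and acts as inversion otherwise. -/
noncomputable def quadrangleReflection (θ : F →+* F) : List F ⊕ List F → List F ⊕ List F
  | Sum.inl [] => Sum.inr [0]
  | Sum.inl [y₁] => Sum.inr [0, y₁]
  | Sum.inl [y₁, y₂] => Sum.inr [0, y₁, y₂]
  | Sum.inl [y₁, y₂, y₃] => Sum.inl [y₃, y₂, y₁]
  | Sum.inr [x₁] => if x₁ = 0 then Sum.inl [] else Sum.inr [x₁⁻¹]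
  | Sum.inr [x₁, x₂] => if x₁ = 0 then Sum.inl [x₂] else Sum.inr [x₁⁻¹, x₂ / θ x₁]
  | Sum.inr [x₁, x₂, x₃] =>
    if x₁ = 0 then Sum.inl [x₂, x₃] else Sum.inr [x₁⁻¹, x₂ / θ x₁, x₃ + θ x₂ / x₁]
  | u => u

lemma isGraphMap_quadrangleShear (θ : F →+* F) (c : F) :
    IsGraphMap (QuadrangleRel θ) 3 (quadrangleShear θ c) where
  size_le u hu := by
    rcases u with (_ | ⟨y₁, _ | ⟨y₂, _ | ⟨y₃, _ | ⟨y₄, l⟩⟩⟩⟩) | (_ | ⟨x₁, l⟩) <;>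
      exact hu
  linked u v hu hv h := by
    cases h with
    | root => exact Or.inl .root
    | left x z =>
      rcases x with _ | ⟨y₁, _ | ⟨y₂, _ | ⟨y₃, l⟩⟩⟩
      · exact Or.inl (.left [] _)
      · exact Or.inl (.left [_] _)
      · exact Or.inl (.left [_, _] _)
      · simp at hv
        omega
    | right x z =>
      rcases x with _ | ⟨x₁, l⟩
      · exact Or.inl (.right [] _)
      · exact Or.inl (.right (_ :: _) _)
    | leaf x y h =>
      obtain ⟨y₁, y₂, y₃, x₁, x₂, x₃, h₁, h₂⟩ := h
      refine Or.inl (.leaf _ _ (.mk _ _ _ _ _ _ ?_ ?_))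
      · rw [map_add]
        linear_combination h₁
      · linear_combination h₂

lemma quadrangleShear_neg (θ : F →+* F) (c : F) (u : List F ⊕ List F) (hu : size u ≤ 3) :
    quadrangleShear θ (-c) (quadrangleShear θ c u) = u := by
  rcases u with (_ | ⟨y₁, _ | ⟨y₂, _ | ⟨y₃, _ | ⟨y₄, l⟩⟩⟩⟩) | (_ | ⟨x₁, l⟩) <;>
    simp [quadrangleShear] at hu ⊢

lemma isGraphMap_quadrangleReflection [CharP F 2] (θ : F →+* F) (hθ : ∀ x, θ (θ x) = x ^ 2) :
    IsGraphMap (QuadrangleRel θ) 3 (quadrangleReflection θ) where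
  size_le u hu := by
    rcases u with (_ | ⟨y₁, _ | ⟨y₂, _ | ⟨y₃, _ | ⟨y₄, l⟩⟩⟩⟩) |
      (_ | ⟨x₁, _ | ⟨x₂, _ | ⟨x₃, _ | ⟨x₄, l⟩⟩⟩⟩) <;>
      simp [quadrangleReflection] at hu ⊢ <;> first | omega | (split_ifs <;> simp)
  linked u v hu hv h := by
    cases h with
    | root => exact Or.inr (by simpa [quadrangleReflection] using Link.right [] (0 : F))
    | left x z =>
      rcases x with _ | ⟨y₁, _ | ⟨y₂, _ | ⟨y₃, l⟩⟩⟩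
      · exact Or.inl (.right [0] _)
      · exact Or.inl (.right [0, _] _)
      · exact Or.inr (.leaf _ _ (.mk _ _ _ _ _ _ (by simp) (by simp)))
      · simp at hv
        omega
    | right x z =>
      rcases x with _ | ⟨x₁, _ | ⟨x₂, _ | ⟨x₃, l⟩⟩⟩
      · by_cases hz : z = 0
        · exact Or.inr (by simpa [quadrangleReflection, hz] using Link.root)
        · exact Or.inl (by simpa [quadrangleReflection, hz] using Link.right [] _)
      · by_cases hx : x₁ = 0
        · exact Or.inl (by simpa [quadrangleReflection, hx] using Link.left [] _)
        · exact Or.inl (by simpa [quadrangleReflection, hx] using Link.right [_] _)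
      · by_cases hx : x₁ = 0
        · exact Or.inl (by simpa [quadrangleReflection, hx] using Link.left [_] _)
        · exact Or.inl (by simpa [quadrangleReflection, hx] using Link.right [_, _] _)
      · simp at hv
        omega
    | leaf x y h =>
      obtain ⟨y₁, y₂, y₃, x₁, x₂, x₃, rfl, rfl⟩ := h
      by_cases hx : x₁ = 0
      · subst hx
        refine Or.inr ?_
        simpa [quadrangleReflection] using Link.left [_, _] _
      · have hx' : θ x₁ ≠ 0 := (map_ne_zero θ).2 hx
        refine Or.inl ?_
        simp only [quadrangleReflection, hx, if_false]
        refine .leaf _ _ (.mk _ _ _ _ _ _ ?_ ?_)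
        · rw [map_inv₀]
          field_simp
          linear_combination (- x₂) * (CharTwo.two_eq_zero : (2 : F) = 0)
        · rw [map_add, map_mul, hθ]
          field_simp
          ring

lemma quadrangleReflection_involutive [CharP F 2] (θ : F →+* F) (hθ : ∀ x, θ (θ x) = x ^ 2)
    (u : List F ⊕ List F) (hu : size u ≤ 3) :
    quadrangleReflection θ (quadrangleReflection θ u) = u := by
  rcases u with (_ | ⟨y₁, _ | ⟨y₂, _ | ⟨y₃, _ | ⟨y₄, l⟩⟩⟩⟩) |
    (_ | ⟨x₁, _ | ⟨x₂, _ | ⟨x₃, _ | ⟨x₄, l⟩⟩⟩⟩)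
  all_goals first | (by_cases hx : x₁ = 0) | skip
  all_goals simp [quadrangleReflection, *] at hu ⊢
  field_simp
  linear_combination θ x₂ * (CharTwo.two_eq_zero : (2 : F) = 0)

end Quadrangle

section Hexagon

variable {F : Type} [Field F]

/-- The leaf relation of the split Cayley hexagon in characteristic three, for an endomorphism `θ`
whose square is the Frobenius endomorphism. -/
inductive HexagonRel (θ : F →+* F) : List F → List F → Prop
  | mk (y₁ y₂ y₃ y₄ y₅ x₁ x₂ x₃ x₄ x₅ : F) (h₁ : y₅ = x₂ + θ x₁ * y₁) (h₂ : x₅ = y₂ + θ y₁ * x₁)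
    (h₃ : y₄ = x₃ + x₁ * x₅ + x₁ ^ 2 * θ y₁) (h₄ : x₄ = y₃ + y₁ * y₅ + y₁ ^ 2 * θ x₁) :
    HexagonRel θ [y₁, y₂, y₃, y₄, y₅] [x₁, x₂, x₃, x₄, x₅]

lemma isLeafRelation_hexagonRel (θ : F →+* F) : IsLeafRelation (HexagonRel θ) 5 where
  pos := by norm_num
  length_left := by rintro _ _ ⟨⟩; rfl
  symm := by
    rintro _ _ ⟨y₁, y₂, y₃, y₄, y₅, x₁, x₂, x₃, x₄, x₅, h₁, h₂, h₃, h₄⟩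
    exact .mk _ _ _ _ _ _ _ _ _ _ h₂ h₁ h₄ h₃
  existsUnique := by
    intro y hy c
    obtain ⟨y₁, y₂, y₃, y₄, y₅, rfl⟩ : ∃ y₁ y₂ y₃ y₄ y₅, y = [y₁, y₂, y₃, y₄, y₅] := by
      rcases y with _ | ⟨y₁, _ | ⟨y₂, _ | ⟨y₃, _ | ⟨y₄, _ | ⟨y₅, _ | ⟨y₆, l⟩⟩⟩⟩⟩⟩ <;> simp at hy
      exact ⟨_, _, _, _, _, rfl⟩
    refine ⟨[c, y₅ - θ c * y₁, y₄ - c * (y₂ + θ y₁ * c) - c ^ 2 * θ y₁,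
      y₃ + y₁ * y₅ + y₁ ^ 2 * θ c, y₂ + θ y₁ * c],
      ⟨.mk _ _ _ _ _ _ _ _ _ _ (by ring) rfl (by ring) rfl, rfl⟩, ?_⟩
    rintro _ ⟨⟨_, _, _, _, _, x₁, x₂, x₃, x₄, x₅, h₁, h₂, h₃, h₄⟩, hc⟩
    obtain rfl : x₁ = c := by simpa using hc
    simp only [List.cons.injEq, and_true, true_and]
    refine ⟨?_, ?_, h₄, h₂⟩
    · linear_combination - h₁
    · linear_combination - h₃ - x₁ * h₂

/-- The automorphism that translates the first coordinates of the right tree by `c`. -/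
def hexagonShear (θ : F →+* F) (c : F) : List F ⊕ List F → List F ⊕ List F
  | Sum.inl [y₁, y₂] => Sum.inl [y₁, y₂ - c * θ y₁]
  | Sum.inl [y₁, y₂, y₃] => Sum.inl [y₁, y₂ - c * θ y₁, y₃ + θ c * y₁ ^ 2]
  | Sum.inl [y₁, y₂, y₃, y₄] =>
    Sum.inl [y₁, y₂ - c * θ y₁, y₃ + θ c * y₁ ^ 2, y₄ + c * y₂ + c ^ 2 * θ y₁]
  | Sum.inl [y₁, y₂, y₃, y₄, y₅] =>
    Sum.inl [y₁, y₂ - c * θ y₁, y₃ + θ c * y₁ ^ 2, y₄ + c * y₂ + c ^ 2 * θ y₁, y₅ + θ c * y₁]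
  | Sum.inr (x₁ :: l) => Sum.inr ((x₁ + c) :: l)
  | u => u

open scoped Classical in
/-- The automorphism that fixes the right root, and with it the set of its neighbours, on which it
exchanges the left root with the first coordinate `0` and acts as inversion otherwise. -/
noncomputable def hexagonReflection (θ : F →+* F) : List F ⊕ List F → List F ⊕ List F
  | Sum.inl [] => Sum.inr [0]
  | Sum.inl [y₁] => Sum.inr [0, y₁]
  | Sum.inl [y₁, y₂] => Sum.inr [0, y₁, -y₂]
  | Sum.inl [y₁, y₂, y₃] => Sum.inr [0, y₁, -y₂, -y₃]
  | Sum.inl [y₁, y₂, y₃, y₄] => Sum.inr [0, y₁, -y₂, -y₃, -y₄]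
  | Sum.inl [y₁, y₂, y₃, y₄, y₅] => Sum.inl [y₅, -y₄, -(y₃ + y₁ * y₅), -y₂, y₁]
  | Sum.inr [x₁] => if x₁ = 0 then Sum.inl [] else Sum.inr [x₁⁻¹]
  | Sum.inr [x₁, x₂] => if x₁ = 0 then Sum.inl [x₂] else Sum.inr [x₁⁻¹, -x₂ / θ x₁]
  | Sum.inr [x₁, x₂, x₃] =>
    if x₁ = 0 then Sum.inl [x₂, -x₃] else
      Sum.inr [x₁⁻¹, -x₂ / θ x₁, x₃ / x₁ + θ x₂ / x₁ ^ 2]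
  | Sum.inr [x₁, x₂, x₃, x₄] =>
    if x₁ = 0 then Sum.inl [x₂, -x₃, -x₄] else
      Sum.inr [x₁⁻¹, -x₂ / θ x₁, x₃ / x₁ + θ x₂ / x₁ ^ 2, -x₄ + x₂ ^ 2 / θ x₁]
  | Sum.inr [x₁, x₂, x₃, x₄, x₅] =>
    if x₁ = 0 then Sum.inl [x₂, -x₃, -x₄, -x₅] else
      Sum.inr [x₁⁻¹, -x₂ / θ x₁, x₃ / x₁ + θ x₂ / x₁ ^ 2, -x₄ + x₂ ^ 2 / θ x₁,
        -(x₃ + x₁ * x₅ - θ x₂ / x₁)]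
  | u => u

lemma isGraphMap_hexagonShear [CharP F 3] (θ : F →+* F) (c : F) :
    IsGraphMap (HexagonRel θ) 5 (hexagonShear θ c) where
  size_le u hu := by
    rcases u with (_ | ⟨y₁, _ | ⟨y₂, _ | ⟨y₃, _ | ⟨y₄, _ | ⟨y₅, _ | ⟨y₆, l⟩⟩⟩⟩⟩⟩) | (_ | ⟨x₁, l⟩) <;>
      exact hu
  linked u v hu hv h := by
    cases h with
    | root => exact Or.inl .root
    | left x z =>
      rcases x with _ | ⟨y₁, _ | ⟨y₂, _ | ⟨y₃, _ | ⟨y₄, _ | ⟨y₅, l⟩⟩⟩⟩⟩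
      · exact Or.inl (.left [] _)
      · exact Or.inl (.left [_] _)
      · exact Or.inl (.left [_, _] _)
      · exact Or.inl (.left [_, _, _] _)
      · exact Or.inl (.left [_, _, _, _] _)
      · simp at hv
        omega
    | right x z =>
      rcases x with _ | ⟨x₁, l⟩
      · exact Or.inl (.right [] _)
      · exact Or.inl (.right (_ :: _) _)
    | leaf x y h =>
      obtain ⟨y₁, y₂, y₃, y₄, y₅, x₁, x₂, x₃, x₄, x₅, rfl, rfl, rfl, rfl⟩ := h
      have h3 : (3 : F) = 0 := CharP.cast_eq_zero F 3
      refine Or.inl (.leaf _ _ (.mk _ _ _ _ _ _ _ _ _ _ ?_ ?_ ?_ ?_))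
      · rw [map_add]; ring
      · ring
      · linear_combination (-c * x₁ * θ y₁) * h3
      · rw [map_add]; linear_combination (-y₁ ^ 2 * θ c) * h3

lemma hexagonShear_neg [CharP F 3] (θ : F →+* F) (c : F) (u : List F ⊕ List F) (hu : size u ≤ 5) :
    hexagonShear θ (-c) (hexagonShear θ c u) = u := by
  rcases u with (_ | ⟨y₁, _ | ⟨y₂, _ | ⟨y₃, _ | ⟨y₄, _ | ⟨y₅, _ | ⟨y₆, l⟩⟩⟩⟩⟩⟩) | (_ | ⟨x₁, l⟩) <;>
    simp [hexagonShear] at hu ⊢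
  all_goals linear_combination (c ^ 2 * θ y₁) * (CharP.cast_eq_zero F 3 : ((3 : ℕ) : F) = 0)

lemma isGraphMap_hexagonReflection [CharP F 3] (θ : F →+* F) (hθ : ∀ x, θ (θ x) = x ^ 3) :
    IsGraphMap (HexagonRel θ) 5 (hexagonReflection θ) where
  size_le u hu := by
    rcases u with (_ | ⟨y₁, _ | ⟨y₂, _ | ⟨y₃, _ | ⟨y₄, _ | ⟨y₅, _ | ⟨y₆, l⟩⟩⟩⟩⟩⟩) |
      (_ | ⟨x₁, _ | ⟨x₂, _ | ⟨x₃, _ | ⟨x₄, _ | ⟨x₅, _ | ⟨x₆, l⟩⟩⟩⟩⟩⟩) <;>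
      simp [hexagonReflection] at hu ⊢ <;> first | omega | (split_ifs <;> simp)
  linked u v hu hv h := by
    cases h with
    | root => exact Or.inr (by simpa [hexagonReflection] using Link.right [] (0 : F))
    | left x z =>
      rcases x with _ | ⟨y₁, _ | ⟨y₂, _ | ⟨y₃, _ | ⟨y₄, _ | ⟨y₅, l⟩⟩⟩⟩⟩
      · exact Or.inl (.right [0] _)
      · exact Or.inl (.right [0, _] _)
      · exact Or.inl (.right [0, _, _] _)
      · exact Or.inl (.right [0, _, _, _] _)
      · exact Or.inr (.leaf _ _ (.mk _ _ _ _ _ _ _ _ _ _ (by simp) (by simp) (by simp)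
          (by simp; ring)))
      · simp at hv
        omega
    | right x z =>
      rcases x with _ | ⟨x₁, _ | ⟨x₂, _ | ⟨x₃, _ | ⟨x₄, _ | ⟨x₅, l⟩⟩⟩⟩⟩
      · by_cases hz : z = 0
        · exact Or.inr (by simpa [hexagonReflection, hz] using Link.root)
        · exact Or.inl (by simpa [hexagonReflection, hz] using Link.right [] _)
      · by_cases hx : x₁ = 0
        · exact Or.inl (by simpa [hexagonReflection, hx] using Link.left [] _)
        · exact Or.inl (by simpa [hexagonReflection, hx] using Link.right [_] _)
      · by_cases hx : x₁ = 0
        · exact Or.inl (by simpa [hexagonReflection, hx] using Link.left [_] _)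
        · exact Or.inl (by simpa [hexagonReflection, hx] using Link.right [_, _] _)
      · by_cases hx : x₁ = 0
        · exact Or.inl (by simpa [hexagonReflection, hx] using Link.left [_, _] _)
        · exact Or.inl (by simpa [hexagonReflection, hx] using Link.right [_, _, _] _)
      · by_cases hx : x₁ = 0
        · exact Or.inl (by simpa [hexagonReflection, hx] using Link.left [_, _, _] _)
        · exact Or.inl (by simpa [hexagonReflection, hx] using Link.right [_, _, _, _] _)
      · simp at hv
        omega
    | leaf x y h =>
      obtain ⟨y₁, y₂, y₃, y₄, y₅, x₁, x₂, x₃, x₄, x₅, rfl, rfl, rfl, rfl⟩ := h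
      have h3 : (3 : F) = 0 := CharP.cast_eq_zero F 3
      by_cases hx : x₁ = 0
      · subst hx
        refine Or.inr ?_
        simpa [hexagonReflection] using Link.left [_, _, _, _] _
      · have hx' : θ x₁ ≠ 0 := (map_ne_zero θ).2 hx
        refine Or.inl ?_
        simp only [hexagonReflection, hx, if_false]
        refine .leaf _ _ (.mk _ _ _ _ _ _ _ _ _ _ ?_ ?_ ?_ ?_)
        · rw [map_inv₀]
          field_simp
          ring
        · rw [map_add, map_mul, hθ]
          field_simp
          ring
        · rw [map_add, map_mul, hθ]
          field_simp
          linear_combination (-θ x₂) * h3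
        · rw [map_inv₀]
          field_simp
          linear_combination (-x₂ * y₁ * θ x₁ - y₁ ^ 2 * θ x₁ ^ 2) * h3

lemma hexagonReflection_involutive [CharP F 3] (θ : F →+* F) (hθ : ∀ x, θ (θ x) = x ^ 3)
    (u : List F ⊕ List F) (hu : size u ≤ 5) :
    hexagonReflection θ (hexagonReflection θ u) = u := by
  rcases u with (_ | ⟨y₁, _ | ⟨y₂, _ | ⟨y₃, _ | ⟨y₄, _ | ⟨y₅, _ | ⟨y₆, l⟩⟩⟩⟩⟩⟩) |
    (_ | ⟨x₁, _ | ⟨x₂, _ | ⟨x₃, _ | ⟨x₄, _ | ⟨x₅, _ | ⟨x₆, l⟩⟩⟩⟩⟩⟩)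
  all_goals first | (by_cases hx : x₁ = 0) | skip
  all_goals simp [hexagonReflection, *] at hu ⊢
  · ring
  · field_simp
    ring
  · have hx' : θ x₁ ≠ 0 := (map_ne_zero θ).2 hx
    constructor <;> field_simp <;> ring
  · have hx' : θ x₁ ≠ 0 := (map_ne_zero θ).2 hx
    have h3 : (3 : F) = 0 := CharP.cast_eq_zero F 3
    refine ⟨by field_simp; ring, by field_simp; ring, ?_⟩
    field_simp
    linear_combination (-θ x₂) * h3

end Hexagon

section Plane

variable {F : Type} [Field F]

/-- The leaf relation of the Desarguesian projective plane. -/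
inductive PlaneRel : List F → List F → Prop
  | mk (y₁ y₂ x₁ x₂ : F) (h : y₂ + x₂ = x₁ * y₁) : PlaneRel [y₁, y₂] [x₁, x₂]

lemma isLeafRelation_planeRel : IsLeafRelation (PlaneRel (F := F)) 2 where
  pos := by norm_num
  length_left := by rintro _ _ ⟨⟩; rfl
  symm := by
    rintro _ _ ⟨y₁, y₂, x₁, x₂, h⟩
    exact .mk _ _ _ _ (by linear_combination h)
  existsUnique := by
    intro x hx c
    obtain ⟨y₁, y₂, rfl⟩ := List.length_eq_two.1 hx
    refine ⟨[c, c * y₁ - y₂], ⟨.mk _ _ _ _ (by ring), rfl⟩, ?_⟩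
    rintro _ ⟨⟨_, _, x₁, x₂, h⟩, hc⟩
    obtain rfl : x₁ = c := by simpa using hc
    rw [← h]
    simp

/-- The automorphism that translates the first coordinates of the right tree by `c`. -/
def planeShear (c : F) : List F ⊕ List F → List F ⊕ List F
  | Sum.inl [y₁, y₂] => Sum.inl [y₁, y₂ + c * y₁]
  | Sum.inr (x₁ :: l) => Sum.inr ((x₁ + c) :: l)
  | u => u

open scoped Classical in
/-- The automorphism that fixes the right root, and with it the set of its neighbours, on which it
exchanges the left root with the first coordinate `0` and acts as inversion otherwise. -/
noncomputable def planeReflection : List F ⊕ List F → List F ⊕ List F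
  | Sum.inl [] => Sum.inr [0]
  | Sum.inl [y₁] => Sum.inr [0, y₁]
  | Sum.inl [y₁, y₂] => Sum.inl [-y₂, -y₁]
  | Sum.inr [x₁] => if x₁ = 0 then Sum.inl [] else Sum.inr [x₁⁻¹]
  | Sum.inr [x₁, x₂] => if x₁ = 0 then Sum.inl [x₂] else Sum.inr [x₁⁻¹, x₂ / x₁]
  | u => u

lemma isGraphMap_planeShear (c : F) : IsGraphMap PlaneRel 2 (planeShear c) where
  size_le u hu := by
    rcases u with (_ | ⟨y₁, _ | ⟨y₂, _ | ⟨y₃, l⟩⟩⟩) | (_ | ⟨x₁, l⟩) <;> exact hu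
  linked u v hu hv h := by
    cases h with
    | root => exact Or.inl .root
    | left x z =>
      rcases x with _ | ⟨y₁, _ | ⟨y₂, l⟩⟩
      · exact Or.inl (.left [] _)
      · exact Or.inl (.left [_] _)
      · simp at hv
    | right x z =>
      rcases x with _ | ⟨x₁, l⟩
      · exact Or.inl (.right [] _)
      · exact Or.inl (.right (_ :: _) _)
    | leaf x y h =>
      obtain ⟨y₁, y₂, x₁, x₂, h⟩ := h
      exact Or.inl (.leaf _ _ (.mk _ _ _ _ (by linear_combination h)))

lemma planeShear_neg (c : F) (u : List F ⊕ List F) (hu : size u ≤ 2) :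
    planeShear (-c) (planeShear c u) = u := by
  rcases u with (_ | ⟨y₁, _ | ⟨y₂, _ | ⟨y₃, l⟩⟩⟩) | (_ | ⟨x₁, l⟩) <;>
    simp [planeShear] at hu ⊢

lemma isGraphMap_planeReflection : IsGraphMap (PlaneRel (F := F)) 2 planeReflection where
  size_le u hu := by
    rcases u with (_ | ⟨y₁, _ | ⟨y₂, _ | ⟨y₃, l⟩⟩⟩) | (_ | ⟨x₁, _ | ⟨x₂, _ | ⟨x₃, l⟩⟩⟩) <;>
      simp [planeReflection] at hu ⊢ <;> first | omega | (split_ifs <;> simp)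
  linked u v hu hv h := by
    cases h with
    | root => exact Or.inr (by simpa [planeReflection] using Link.right [] (0 : F))
    | left x z =>
      rcases x with _ | ⟨y₁, _ | ⟨y₂, l⟩⟩
      · exact Or.inl (.right [0] _)
      · exact Or.inr (.leaf _ _ (.mk _ _ _ _ (by simp)))
      · simp at hv
    | right x z =>
      rcases x with _ | ⟨x₁, _ | ⟨x₂, l⟩⟩
      · by_cases hz : z = 0
        · exact Or.inr (by simpa [planeReflection, hz] using Link.root)
        · exact Or.inl (by simpa [planeReflection, hz] using Link.right [] _)
      · by_cases hx : x₁ = 0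
        · exact Or.inl (by simpa [planeReflection, hx] using Link.left [] _)
        · exact Or.inl (by simpa [planeReflection, hx] using Link.right [_] _)
      · simp at hv
    | leaf x y h =>
      obtain ⟨y₁, y₂, x₁, x₂, h⟩ := h
      by_cases hx : x₁ = 0
      · subst hx
        obtain rfl : x₂ = -y₂ := by linear_combination h
        refine Or.inr ?_
        simpa [planeReflection] using Link.left [_] _
      · refine Or.inl ?_
        simp only [planeReflection, hx, if_false]
        refine .leaf _ _ (.mk _ _ _ _ ?_)
        field_simp
        linear_combination h

lemma planeReflection_involutive (u : List F ⊕ List F) (hu : size u ≤ 2) :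
    planeReflection (planeReflection u) = u := by
  rcases u with (_ | ⟨y₁, _ | ⟨y₂, _ | ⟨y₃, l⟩⟩⟩) | (_ | ⟨x₁, _ | ⟨x₂, _ | ⟨x₃, l⟩⟩⟩)
  all_goals first | (by_cases hx : x₁ = 0) | skip
  all_goals simp [planeReflection, *] at hu ⊢

end Plane

end TreeGeometry

/-! ### Existence of polarities, and the theorem -/

/-- In characteristic `p`, a field with `p ^ (2 e + 1)` elements has an endomorphism whose square is
the Frobenius endomorphism. -/
lemma iterateFrobenius_iterateFrobenius_of_card {F : Type*} [Field F] [Finite F] (p : ℕ)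
    [Fact p.Prime] [CharP F p] {e : ℕ} (hF : Nat.card F = p ^ (2 * e + 1)) (x : F) :
    iterateFrobenius F p (e + 1) (iterateFrobenius F p (e + 1) x) = x ^ p := by
  have := Fintype.ofFinite F
  rw [iterateFrobenius_def, iterateFrobenius_def, ← pow_mul, ← pow_add,
    show e + 1 + (e + 1) = 2 * e + 1 + 1 by ring, pow_succ, ← hF, Nat.card_eq_fintype_card, pow_mul,
    FiniteField.pow_card]

open TreeGeometry in
theorem exists_polygon_of_isPolarityOrder {k q : ℕ} (h : IsPolarityOrder k q) :
    ∃ (P L : Type) (_ : Finite P) (_ : Finite L) (I : P → L → Prop),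
      IsGeneralizedPolygon I (k + 1) ∧ HasOrder I q ∧ Nonempty (Polarity I) := by
  rcases h with ⟨rfl, p, n, hp, hn, rfl⟩ | ⟨rfl, e, rfl⟩ | ⟨rfl, e, rfl⟩
  · have : Fact p.Prime := ⟨hp.nat_prime⟩
    rw [← GaloisField.card p n hn.ne']
    exact exists_polygon_of_maps isLeafRelation_planeRel isGraphMap_planeShear planeShear_neg
      (fun _ => rfl) (fun _ _ => rfl) isGraphMap_planeReflection planeReflection_involutive rfl
      (by simp [planeReflection])
  · have hcard := GaloisField.card 2 (2 * e + 1) (by omega)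
    have hθ := iterateFrobenius_iterateFrobenius_of_card 2 hcard
    rw [← hcard]
    exact exists_polygon_of_maps (isLeafRelation_quadrangleRel _) (isGraphMap_quadrangleShear _)
      (quadrangleShear_neg _) (fun _ => rfl) (fun _ _ => rfl) (isGraphMap_quadrangleReflection _ hθ)
      (quadrangleReflection_involutive _ hθ) rfl (by simp [quadrangleReflection])
  · have hcard := GaloisField.card 3 (2 * e + 1) (by omega)
    have hθ := iterateFrobenius_iterateFrobenius_of_card 3 hcard
    rw [← hcard]
    exact exists_polygon_of_maps (isLeafRelation_hexagonRel _) (isGraphMap_hexagonShear _)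
      (hexagonShear_neg _) (fun _ => rfl) (fun _ _ => rfl) (isGraphMap_hexagonReflection _ hθ)
      (hexagonReflection_involutive _ hθ) rfl (by simp [hexagonReflection])

theorem theorem1 (k : ℕ) (hk : 2 ≤ k) :
    (∀ n : ℕ, (exCycles n (shortEvenLengths k) : ℝ) ≤
      1 / 2 * (n : ℝ) ^ (1 + 1 / (k : ℝ)) + 2 ^ (k ^ 2) * (n : ℝ)) ∧
    (k = 2 ∨ k = 3 ∨ k = 5 →
      (∃ C : ℝ, ∀ (P L : Type*) [Finite P] [Finite L] (I : P → L → Prop) (q : ℕ)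
        (π : Polarity I), IsGeneralizedPolygon I (k + 1) → HasOrder I q →
          CycleFree (shortEvenLengths k) π.graph ∧
          |(π.graph.edgeSet.ncard : ℝ) - 1 / 2 * (Nat.card P : ℝ) ^ (1 + 1 / (k : ℝ))| ≤
            C * (Nat.card P : ℝ)) ∧
      (∀ q : ℕ, IsPolarityOrder k q →
        ∃ (P L : Type) (_ : Finite P) (_ : Finite L) (I : P → L → Prop),
          IsGeneralizedPolygon I (k + 1) ∧ HasOrder I q ∧ Nonempty (Polarity I))) :=
  ⟨exCycles_le hk, fun _ => ⟨⟨1 / 2, fun _ _ _ _ _ _ π h hq =>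
    ⟨cycleFree_polarityGraph h π (Nat.lt_succ_self k),
      abs_card_edgeSet_polarityGraph_sub_le (by omega) h hq π⟩⟩,
    fun _ => exists_polygon_of_isPolarityOrder⟩⟩
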